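/- **Setting.** Fix integers $d_z,d_x,d_a\ge 0$ and $T\ge 1$, a noise variance $\sigma^2\ge 0$, and a nonempty set $\mathcal A\subseteq\mathbb R^{d_a}$. A model $\theta=(f,p,G)$ consists of a decoder $f:\mathbb R^{d_z}\to\mathbb R^{d_x}$, transition densities $p(z^t\mid z^{<t},a^{<t})$ for $t\in[T]$, where $z^t\in\mathbb R^{d_z}$, $z^{<t}=(z^1,\dots,z^{t-1})$ and $a^{<t}=(a^0,\dots,a^{t-1})$, and binary matrices $G^z\in\{0,1\}^{d_z\times d_z}$, $G^a\in\{0,1\}^{d_z\times d_a}$. The mechanism $p(z^t_i\mid z^{<t},a^{<t})$ is the $i$-th marginal of $p(\cdot\mid z^{<t},a^{<t})$. Binary and real matrices are compared as index sets: $A\subseteq B$ means $A_{ij}\neq 0\Rightarrow B_{ij}\ne 0$; $\|G\|_0$ is the number of nonzero entries of $G$; $\mathbb R^{m\times n}_G=\{M\in\mathbb R^{m\times n}: G_{ij}=0\Rightarrow M_{ij}=0\}$. Let $\theta=(f,p,G)$ and $\hat\theta=(\hat f,\hat p,\hat G)$ be two models, each satisfying: 1. (Observation model) $d_z\le d_x$,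 $f$ is a $C^1$ diffeomorphism onto its image (the inverse extends to a $C^1$ map on an open set containing the image), and $f(\mathbb R^{d_z})$ is closed. Given $a^{<T}\in\mathcal A^T$, the observations are $x^t=f(z^t)+n^t$, $t\in[T]$, where $z^{\le T}$ has density $\prod_{t=1}^T p(z^t\mid z^{<t},a^{<t})$ and the $n^t\sim\mathcal N(0,\sigma^2 I)$ are independent of each other and of $z^{\le T}$. 2. (Conditional independence) For all $t\in[T]$, $z^{<t}$ and $a^{<t}\in\mathcal A^t$, $p(\cdot\mid z^{<t},a^{<t})$ is a probability density on $\mathbb R^{d_z}$, equal to $\prod_{i}p(z^t_i\mid z^{<t},a^{<t})$, and the distribution with density $p(z_i^t\mid z^{<t},a^{<t})$ has support $\mathbb R$ for every $i$. 3. (Markov property) Over $a^{<t}\in\mathcal A^t$, $p(z^t_i\mid z^{<t},a^{<t})$ depends on $(z^{<t},a^{<t})$ only through the coordinates $z^s_j$ with $G^z_{ij}=1$ and $a^s_\ell$ with $G^a_{i\ell}=1$. 4. (Smoothness) For all $t\in[T]$, all $i$ and every fixed $a^{<t}\in\mathcal A^t$, $p(z^t_i\mid z^{<t},a^{<t})$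 is $C^2$ as a function of $(z^t_i,z^{<t})$. **Assumptions.** (i) (Observational equivalence) For every $a^{<T}\in\mathcal A^T$ the two models induce the same distribution of $x^{\le T}$ given $a^{<T}$. (ii) (Sufficient influence of $z$) For Lebesgue-almost every $z\in\mathbb R^{d_z}$ there exist $(t_{(r)},\tau_{(r)},z_{(r)},a_{(r)})$, $r=1,\dots,\|G^z\|_0$, with $t_{(r)}\in[T]$, $1\le \tau_{(r)}<t_{(r)}$, $z_{(r)}\in\mathbb R^{d_z\times(t_{(r)}-1)}$, $a_{(r)}\in\mathcal A^{t_{(r)}}$, $z_{(r)}^{\tau_{(r)}}=z$ and $p(z\mid z_{(r)},a_{(r)})>0$, such that $$\mathrm{span}\Big\{H^{t_{(r)},\tau_{(r)}}_{z,z}\log p(z\mid z_{(r)},a_{(r)})\Big\}_{r=1}^{\|G^z\|_0}=\mathbb R^{d_z\times d_z}_{G^z},$$ where $H^{t,\tau}_{z,z}\log p$ is the matrix whose $(i,j)$ entry is $\partial^2\log p(z^t\mid z^{<t},a^{<t})/\partial z^t_i\,\partial z^\tau_j$. **Conclusion.** There is a permutation matrix $P$ with $PG^zP^\top\subseteq\hat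 G^z$. If moreover $\|\hat G^z\|_0\le\|G^z\|_0$, then $\theta$ and $\hat\theta$ are $z$-consistent: there is a permutation matrix $P$ such that * $\theta$ and $\hat\theta$ are equivalent up to diffeomorphism: $f(\mathbb R^{d_z})=\hat f(\mathbb R^{d_z})$, the map $v:=f^{-1}\circ\hat f$ is a diffeomorphism of $\mathbb R^{d_z}$, and $\hat p(z^t\mid z^{<t},a^{<t})=p(v(z^t)\mid v(z^{<t}),a^{<t})\,|\det Dv(z^t)|$ for all $t\in[T]$, $z^{\le t}\in\mathbb R^{d_z\times t}$ and $a^{<t}\in\mathcal A^t$, with $v$ applied to $z^{<t}$ vector by vector; * $\hat G^z=PG^zP^\top$; * $v=c\circ P^\top$ for a diffeomorphism $c$ of $\mathbb R^{d_z}$ that is both $G^z$-preserving and $(G^z)^\top$-preserving. Here $c:\mathbb R^m\to\mathbb R^m$ is $G$-preserving, for $G\in\{0,1\}^{m\times n}$, when its dependency graph $C\in\{0,1\}^{m\times m}$ satisfies $C^\top\mathbb R^{m\times n}_G\subseteq\mathbb R^{m\times n}_G$; the entry $C_{ij}$ is $0$ if and only if $c_i(u)$ is a function of $u$ with its $j$-th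 coordinate removed. -/

import Mathlib

open MeasureTheory ProbabilityTheory
open scoped NNReal

noncomputable section

namespace MechanismSparsity

/-! ### Binary matrices, supports and graph preserving maps -/

/-- Binary matrices `{0,1}^{m × n}`. -/
abbrev BinMatrix (m n : ℕ) := Matrix (Fin m) (Fin n) Bool

/-- A binary matrix seen as a real matrix with entries `0` and `1`. -/
def BinMatrix.toReal {m n : ℕ} (B : BinMatrix m n) : Matrix (Fin m) (Fin n) ℝ :=
  Matrix.of fun i j => if B i j = true then 1 else 0

/-- The number `‖B‖₀` of nonzero entries. -/
def BinMatrix.nnz {m n : ℕ} (B : BinMatrix m n) : ℕ :=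
  (Finset.univ.filter fun q : Fin m × Fin n => B q.1 q.2 = true).card

/-- `A ⊆ B` for matrices identified with the index sets of their nonzero entries. -/
def SuppSubset {m n : ℕ} (A B : Matrix (Fin m) (Fin n) ℝ) : Prop :=
  ∀ i j, A i j ≠ 0 → B i j ≠ 0

/-- The aligned subspace `ℝ^{m × n}_B` of the matrices `M` with `M i j = 0` whenever
`B i j = 0`. -/
def alignedSubspace {m n : ℕ} (B : BinMatrix m n) :
    Submodule ℝ (Matrix (Fin m) (Fin n) ℝ) where
  carrier := {M | ∀ i j, B i j = false → M i j = 0}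
  add_mem' := by
    intro M N hM hN i j h
    simp [hM i j h, hN i j h]
  zero_mem' := by
    intro i j _
    rfl
  smul_mem' := by
    intro c M hM i j h
    simp [hM i j h]

/-- `C` is `G`-preserving: `Cᵀ ℝ^{m × n}_G ⊆ ℝ^{m × n}_G`. -/
def PreservingMatrix {m n : ℕ} (G : BinMatrix m n) (C : Matrix (Fin m) (Fin m) ℝ) : Prop :=
  ∀ M ∈ alignedSubspace G, C.transpose * M ∈ alignedSubspace G

open Classical in
/-- The dependency graph of `h : ℝⁿ → ℝᵐ`: the entry `(i, j)` is `0` iff `h_i(a)` is a function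
of `a` with its `j`-th coordinate removed. -/
def dependencyGraph {m n : ℕ} (h : (Fin n → ℝ) → (Fin m → ℝ)) : BinMatrix m n :=
  Matrix.of fun i j =>
    if ∃ hbar : ({k : Fin n // k ≠ j} → ℝ) → ℝ,
        ∀ a : Fin n → ℝ, h a i = hbar (fun k => a k)
    then false else true

/-- `c : ℝᵐ → ℝᵐ` is `G`-preserving: its dependency graph is a `G`-preserving matrix. -/
def PreservingFunction {m n : ℕ} (G : BinMatrix m n) (c : (Fin m → ℝ) → (Fin m → ℝ)) : Prop :=
  PreservingMatrix G (dependencyGraph c).toReal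

/-! ### Diffeomorphisms and entanglement maps -/

/-- `f : ℝᵐ → ℝⁿ` is a diffeomorphism onto its image: it is `C¹`, injective, and its inverse
`f(ℝᵐ) → ℝᵐ` is the restriction of a `C¹` map defined on an open set containing `f(ℝᵐ)`. -/
def IsDiffeoOntoImage {m n : ℕ} (f : (Fin m → ℝ) → (Fin n → ℝ)) : Prop :=
  ContDiff ℝ 1 f ∧ Function.Injective f ∧
    ∃ (U : Set (Fin n → ℝ)) (g : (Fin n → ℝ) → (Fin m → ℝ)),
      IsOpen U ∧ Set.range f ⊆ U ∧ ContDiffOn ℝ 1 g U ∧ ∀ z, g (f z) = z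

/-- Diffeomorphisms of `ℝᵐ`. -/
def IsDiffeo {m : ℕ} (v : (Fin m → ℝ) → (Fin m → ℝ)) : Prop :=
  IsDiffeoOntoImage v ∧ Function.Surjective v

/-- The entanglement map `v = f⁻¹ ∘ f'` (meaningful when `f` is injective and the images of `f`
and `f'` agree). -/
def entanglementMap {m n : ℕ} (f f' : (Fin m → ℝ) → (Fin n → ℝ)) :
    (Fin m → ℝ) → (Fin m → ℝ) :=
  Function.invFun f ∘ f'

/-! ### The latent variable model

Time is indexed from `0`: the index `t : Fin T` stands for the time step `t + 1`, whose past
latents are `t` vectors of `ℝ^{dz}` and whose past auxiliary variables are `t + 1` vectors of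
`ℝ^{da}`. -/

/-- A model `θ = (f, p, G)`, with `f` the decoder, `p t z h a` the conditional density at `z` of
the latents given the past latents `h` and the past auxiliary variables `a`, and
`G = [Gz, Ga]` the dependency graph. -/
structure Model (dz dx da T : ℕ) where
  f : (Fin dz → ℝ) → (Fin dx → ℝ)
  p : (t : Fin T) → (Fin dz → ℝ) → (Fin (t : ℕ) → Fin dz → ℝ) →
    (Fin ((t : ℕ) + 1) → Fin da → ℝ) → ℝ
  Gz : BinMatrix dz dz
  Ga : BinMatrix dz da

/-- The first `t` terms of a sequence of latents. -/
def pastLatents {dz T : ℕ} (z : Fin T → Fin dz → ℝ) (t : Fin T) : Fin (t : ℕ) → Fin dz → ℝ :=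
  fun s => z ⟨s, s.2.trans t.2⟩

/-- The first `t + 1` terms of a sequence of auxiliary variables. -/
def pastAux {da T : ℕ} (a : Fin T → Fin da → ℝ) (t : Fin T) :
    Fin ((t : ℕ) + 1) → Fin da → ℝ :=
  fun s => a ⟨s, lt_of_lt_of_le s.2 t.2⟩

namespace Model

variable {dz dx da T : ℕ}

/-- The mechanism `p(z_i^t = x | z^{<t} = h, a^{<t} = a)`, that is, the `i`-th marginal of the
transition density. -/
def mechanism (θ : Model dz dx da T) (t : Fin T) (i : Fin dz) (x : ℝ)
    (h : Fin (t : ℕ) → Fin dz → ℝ) (a : Fin ((t : ℕ) + 1) → Fin da → ℝ) : ℝ :=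
  ∫ w : {j : Fin dz // j ≠ i} → ℝ,
    θ.p t (fun j => if hj : j = i then x else w ⟨j, hj⟩) h a

/-- Observation model: `dz ≤ dx`, and the decoder is a diffeomorphism onto its image, which is
closed. (The noise enters through the law of the observations.) -/
def ObservationModel (θ : Model dz dx da T) : Prop :=
  dz ≤ dx ∧ IsDiffeoOntoImage θ.f ∧ IsClosed (Set.range θ.f)

/-- Conditionally independent latent factors: for auxiliary variables in `A`, the transition
model is a probability density, it is the product of the mechanisms, and the distribution given by
each mechanism has support `ℝ`. -/
def CondIndep (θ : Model dz dx da T) (A : Set (Fin da → ℝ)) : Prop :=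
  ∀ (t : Fin T) (h : Fin (t : ℕ) → Fin dz → ℝ) (a : Fin ((t : ℕ) + 1) → Fin da → ℝ),
    (∀ s, a s ∈ A) →
      (∀ z, 0 ≤ θ.p t z h a) ∧
      Integrable (fun z => θ.p t z h a) ∧
      (∫ z, θ.p t z h a) = 1 ∧
      (∀ z, θ.p t z h a = ∏ i, θ.mechanism t i (z i) h a) ∧
      ∀ i, ((volume : Measure ℝ).withDensity
        fun x => ENNReal.ofReal (θ.mechanism t i x h a)).support = Set.univ

/-- The transition model is Markov with respect to `G`: the `i`-th mechanism depends on the past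
only through the parents of `i` in `Gz` and `Ga`. -/
def Markov (θ : Model dz dx da T) (A : Set (Fin da → ℝ)) : Prop :=
  ∀ (t : Fin T) (i : Fin dz) (h h' : Fin (t : ℕ) → Fin dz → ℝ)
    (a a' : Fin ((t : ℕ) + 1) → Fin da → ℝ),
    (∀ s, a s ∈ A) → (∀ s, a' s ∈ A) →
    (∀ s j, θ.Gz i j = true → h s j = h' s j) →
    (∀ s l, θ.Ga i l = true → a s l = a' s l) →
    ∀ x, θ.mechanism t i x h a = θ.mechanism t i x h' a'

/-- Smoothness of the transition model: for all values in `A` of the auxiliary variables, every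
mechanism is `C²` in `(z_i^t, z^{<t})`. Joint `C²` smoothness in `(z_i^t, z^{<t}, a^{<t})` is not
needed and would be a stronger hypothesis. -/
def SmoothTransition (θ : Model dz dx da T) (A : Set (Fin da → ℝ)) : Prop :=
  ∀ (t : Fin T) (i : Fin dz) (a : Fin ((t : ℕ) + 1) → Fin da → ℝ), (∀ s, a s ∈ A) →
    ContDiff ℝ 2 fun q : ℝ × (Fin (t : ℕ) → Fin dz → ℝ) => θ.mechanism t i q.1 q.2 a

/-- The law of the latents `z^{≤ T}` given the auxiliary variables `a^{< T}`. -/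
def latentLaw (θ : Model dz dx da T) (a : Fin T → Fin da → ℝ) :
    Measure (Fin T → Fin dz → ℝ) :=
  volume.withDensity fun z =>
    ENNReal.ofReal (∏ t, θ.p t (z t) (pastLatents z t) (pastAux a t))

/-- The law of the observations `x^t = f(z^t) + n^t`, `t ≤ T`, given `a^{< T}`, where the `n^t` are
independent centered Gaussians with covariance `σ2 • I`, independent of the latents. The value
`σ2 = 0` is allowed and means that there is no noise. -/
def observationLaw (θ : Model dz dx da T) (σ2 : ℝ≥0) (a : Fin T → Fin da → ℝ) :
    Measure (Fin T → Fin dx → ℝ) :=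
  ((θ.latentLaw a).prod
    (Measure.pi fun _ : Fin T => Measure.pi fun _ : Fin dx => gaussianReal 0 σ2)).map
      fun q t => θ.f (q.1 t) + q.2 t

/-- The matrix `H^{t,τ}_{z,z} log p(z | h, a)`, with `(i, j)` entry the second derivative of
`log p` with respect to `z_i^t` and `z_j^τ`. -/
def hessianLog (θ : Model dz dx da T) (t : Fin T) (τ : Fin (t : ℕ)) (z : Fin dz → ℝ)
    (h : Fin (t : ℕ) → Fin dz → ℝ) (a : Fin ((t : ℕ) + 1) → Fin da → ℝ) :
    Matrix (Fin dz) (Fin dz) ℝ :=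
  Matrix.of fun i j =>
    fderiv ℝ (fun h' : Fin (t : ℕ) → Fin dz → ℝ =>
      fderiv ℝ (fun z' : Fin dz → ℝ => Real.log (θ.p t z' h' a)) z (Pi.single i 1))
      h (Pi.single τ (Pi.single j 1))

/-- Sufficient influence of `z`: for almost all `z` there are `‖Gz‖₀` choices of times `τ < t`,
past latents with `z^τ = z` and past auxiliary variables such that the matrices
`H^{t,τ}_{z,z} log p`, taken at `z^t = z`, span `ℝ^{dz × dz}_{Gz}`. The density is required to be
positive where the derivatives of its logarithm are taken. -/
def SufficientInfluence (θ : Model dz dx da T) (A : Set (Fin da → ℝ)) : Prop :=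
  ∀ᵐ z : Fin dz → ℝ,
    ∃ (t : Fin θ.Gz.nnz → Fin T) (τ : ∀ r, Fin (t r : ℕ))
      (h : ∀ r, Fin (t r : ℕ) → Fin dz → ℝ) (a : ∀ r, Fin ((t r : ℕ) + 1) → Fin da → ℝ),
      (∀ r s, a r s ∈ A) ∧
      (∀ r, h r (τ r) = z) ∧
      (∀ r, 0 < θ.p (t r) z (h r) (a r)) ∧
      Submodule.span ℝ (Set.range fun r => θ.hessianLog (t r) (τ r) z (h r) (a r)) =
        alignedSubspace θ.Gz

/-- Observational equivalence: for all values of the auxiliary variables, both models induce the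
same distribution over the observations. -/
def ObsEquiv (σ2 : ℝ≥0) (A : Set (Fin da → ℝ)) (θ θ' : Model dz dx da T) : Prop :=
  ∀ a : Fin T → Fin da → ℝ, (∀ s, a s ∈ A) →
    θ.observationLaw σ2 a = θ'.observationLaw σ2 a

/-- Equivalence up to diffeomorphism. -/
def DiffEquiv (A : Set (Fin da → ℝ)) (θ θ' : Model dz dx da T) : Prop :=
  Set.range θ.f = Set.range θ'.f ∧
  IsDiffeo (entanglementMap θ.f θ'.f) ∧
  ∀ (t : Fin T) (a : Fin ((t : ℕ) + 1) → Fin da → ℝ), (∀ s, a s ∈ A) →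
    ∀ (z : Fin dz → ℝ) (h : Fin (t : ℕ) → Fin dz → ℝ),
      θ'.p t z h a =
        θ.p t (entanglementMap θ.f θ'.f z) (fun s => entanglementMap θ.f θ'.f (h s)) a *
          |(fderiv ℝ (entanglementMap θ.f θ'.f) z).det|

/-- `z`-consistency: for some permutation matrix `P`, the models are equivalent up to
diffeomorphism, `Gz' = P Gz Pᵀ`, and the entanglement map is `c ∘ Pᵀ` for a diffeomorphism `c`
that is `Gz`-preserving and `Gzᵀ`-preserving. -/
def ZConsistent (A : Set (Fin da → ℝ)) (θ θ' : Model dz dx da T) : Prop :=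
  ∃ (π : Equiv.Perm (Fin dz)) (P : Matrix (Fin dz) (Fin dz) ℝ),
    P = π.permMatrix ℝ ∧
    DiffEquiv A θ θ' ∧
    θ'.Gz.toReal = P * θ.Gz.toReal * P.transpose ∧
    ∃ c : (Fin dz → ℝ) → (Fin dz → ℝ),
      IsDiffeo c ∧ PreservingFunction θ.Gz c ∧ PreservingFunction θ.Gz.transpose c ∧
      ∀ z, entanglementMap θ.f θ'.f z = c (P.transpose.mulVec z)

end Model

end MechanismSparsity

end

open MechanismSparsity

namespace MechanismSparsity

open Filter Topology
open scoped ENNReal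

/-! ### Removing the noise -/

/-! The characteristic function of the noise never vanishes (also for `σ2 = 0`), so the laws of the
noiseless observations agree. Each latent law charges every nonempty open set and the images of the
decoders are closed, so the images coincide, and `v = f⁻¹ ∘ f'` is a diffeomorphism carrying the
latent law of `θ'` to that of `θ`. The change of variables formula relates the joint densities;
integrating out the last time steps relates the transition densities (`diffEquiv_of_obsEquiv`).

Take logarithms and differentiate in the past `z^τ`, then in the present `z^t`. The term `log |det
Dv(z^t)|` does not involve the past and drops out, leaving `H' = Dv(z^t)ᵀ H Dv(z^τ)`. By the Markov
property `H'` vanishes off `G'`. Where both latents equal `w`, sufficient influence lets every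
matrix aligned with `G` replace `H`. Hence `∂_i v_k · ∂_j v_l = 0` at `w` whenever `G k l = 1` and
`G' i j = 0`; this holds for a dense set of `w`, then everywhere by continuity
(`fderiv_mul_fderiv_eq_zero`).

A nonzero term of the Leibniz expansion of `det Dv(0)` gives a permutation `π` embedding `G` in
`G'`, an isomorphism if `G'` has no more edges than `G`. The permutation found this way could vary
with the point. For `c`, which is `v` with its arguments relabelled by `π`, a connectedness argument
shows that all Jacobians have support in one preorder on the nodes (`dominates_of_ne_zero`). This
preorder encodes preservation of both `G` and `Gᵀ`. -/

lemma charFunDual_gaussianReal_ne_zero (m : ℝ) (v : ℝ≥0) (L : StrongDual ℝ ℝ) :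
    charFunDual (gaussianReal m v) L ≠ 0 := by
  rw [IsGaussian.charFunDual_eq]
  exact Complex.exp_ne_zero _

lemma charFunDual_pi_ne_zero {ι : Type*} [Fintype ι] {E : Type*} [NormedAddCommGroup E]
    [NormedSpace ℝ E] [MeasurableSpace E] {μ : ι → Measure E} [∀ i, SigmaFinite (μ i)]
    (h : ∀ i L, charFunDual (μ i) L ≠ 0) (L : StrongDual ℝ (ι → E)) :
    charFunDual (Measure.pi μ) L ≠ 0 := by
  classical
  rw [charFunDual_pi]
  exact Finset.prod_ne_zero_iff.mpr fun i _ => h i _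

/-- Convolution with a finite measure whose characteristic function does not vanish is
injective. -/
lemma eq_of_conv_eq_of_charFunDual_ne_zero {E : Type*} [NormedAddCommGroup E] [NormedSpace ℝ E]
    [MeasurableSpace E] [BorelSpace E] [SecondCountableTopology E] [CompleteSpace E]
    {μ μ' ν : Measure E} [IsFiniteMeasure μ] [IsFiniteMeasure μ'] [IsFiniteMeasure ν]
    (hν : ∀ L, charFunDual ν L ≠ 0) (h : μ.conv ν = μ'.conv ν) : μ = μ' := by
  refine Measure.ext_of_charFunDual (funext fun L => mul_right_cancel₀ (hν L) ?_)
  rw [← charFunDual_conv, ← charFunDual_conv, h]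

lemma Model.observationLaw_eq_conv {dz dx da T : ℕ} (θ : Model dz dx da T) (hf : Measurable θ.f)
    (σ2 : ℝ≥0) (a : Fin T → Fin da → ℝ) [SFinite (θ.latentLaw a)] :
    θ.observationLaw σ2 a = ((θ.latentLaw a).map fun z t => θ.f (z t)).conv
      (Measure.pi fun _ : Fin T => Measure.pi fun _ : Fin dx => gaussianReal 0 σ2) := by
  have hF : Measurable fun (z : Fin T → Fin dz → ℝ) t => θ.f (z t) := by fun_prop
  have h := Measure.map_prod_map (θ.latentLaw a) (Measure.pi fun _ : Fin T =>
    Measure.pi fun _ : Fin dx => gaussianReal 0 σ2) hF measurable_id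
  rw [Measure.map_id] at h
  rw [Model.observationLaw, Measure.conv, h, Measure.map_map (by fun_prop) (by fun_prop)]
  rfl

/-- Equality of the laws of the noisy observations gives equality of the laws of the noiseless
observations. -/
lemma Model.map_latentLaw_eq {dz dx da T : ℕ} {θ θ' : Model dz dx da T} (hf : Measurable θ.f)
    (hf' : Measurable θ'.f) {σ2 : ℝ≥0} {a : Fin T → Fin da → ℝ}
    [IsFiniteMeasure (θ.latentLaw a)] [IsFiniteMeasure (θ'.latentLaw a)]
    (h : θ.observationLaw σ2 a = θ'.observationLaw σ2 a) :
    ((θ.latentLaw a).map fun z t => θ.f (z t)) = (θ'.latentLaw a).map fun z t => θ'.f (z t) := by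
  rw [θ.observationLaw_eq_conv hf, θ'.observationLaw_eq_conv hf'] at h
  exact eq_of_conv_eq_of_charFunDual_ne_zero (charFunDual_pi_ne_zero fun _ =>
    charFunDual_pi_ne_zero fun _ => charFunDual_gaussianReal_ne_zero _ _) h

/-! ### Products of transition densities -/

section Sequential

variable {dz T : ℕ}

lemma pastLatents_update_of_le (z : Fin T → Fin dz → ℝ) {k t : Fin T} (x : Fin dz → ℝ)
    (h : t ≤ k) : pastLatents (Function.update z k x) t = pastLatents z t := by
  funext s
  have : (⟨s, s.2.trans t.2⟩ : Fin T) ≠ k := fun he => by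
    have := congrArg Fin.val he
    have h1 := s.2
    have h2 : (t : ℕ) ≤ k := h
    simp only at this
    omega
  simp [pastLatents, Function.update_of_ne this]

/-- The product of the values along `z` of the first `k` of the functions `q t`. -/
def partialProd {R : Type*} [CommMonoid R] (q : (t : Fin T) → (Fin dz → ℝ) →
    (Fin (t : ℕ) → Fin dz → ℝ) → R) (k : ℕ) (z : Fin T → Fin dz → ℝ) : R :=
  ∏ t with (t : Fin T).1 < k, q t (z t) (pastLatents z t)

variable {R : Type*} [CommMonoid R]
  (q : (t : Fin T) → (Fin dz → ℝ) → (Fin (t : ℕ) → Fin dz → ℝ) → R)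

lemma partialProd_zero (z : Fin T → Fin dz → ℝ) : partialProd q 0 z = 1 := by
  simp [partialProd]

lemma partialProd_last (z : Fin T → Fin dz → ℝ) :
    partialProd q T z = ∏ t, q t (z t) (pastLatents z t) := by
  simp [partialProd]

lemma partialProd_succ (k : Fin T) (z : Fin T → Fin dz → ℝ) :
    partialProd q (k + 1) z = partialProd q k z * q k (z k) (pastLatents z k) := by
  have : (Finset.univ.filter fun t : Fin T => t.1 < k + 1) =
      insert k (Finset.univ.filter fun t : Fin T => t.1 < k) := by
    ext t
    simp only [Finset.mem_filter, Finset.mem_univ, true_and, Finset.mem_insert, Fin.ext_iff]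
    omega
  rw [partialProd, this, Finset.prod_insert (by simp), mul_comm, partialProd]

lemma partialProd_update (k : Fin T) (x : Fin dz → ℝ) (z : Fin T → Fin dz → ℝ) :
    partialProd q k (Function.update z k x) = partialProd q k z := by
  refine Finset.prod_congr rfl fun t ht => ?_
  have ht : t < k := (Finset.mem_filter.mp ht).2
  rw [Function.update_of_ne ht.ne, pastLatents_update_of_le _ _ ht.le]

lemma partialProd_succ_update (k : Fin T) (x : Fin dz → ℝ) (z : Fin T → Fin dz → ℝ) :
    partialProd q (k + 1) (Function.update z k x) =
      partialProd q k z * q k x (pastLatents z k) := by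
  rw [partialProd_succ, partialProd_update, Function.update_self,
    pastLatents_update_of_le _ _ le_rfl]

/-- The earlier factors do not see coordinate `k`, so they leave the integral, and the remaining
factor integrates to one. -/
lemma lintegral_partialProd_update
    {q : (t : Fin T) → (Fin dz → ℝ) → (Fin (t : ℕ) → Fin dz → ℝ) → ℝ≥0∞}
    (hm : ∀ t h, Measurable fun x => q t x h) (hq : ∀ t h, ∫⁻ x, q t x h = 1)
    (k : Fin T) (z : Fin T → Fin dz → ℝ) :
    ∫⁻ x, partialProd q (k + 1) (Function.update z k x) = partialProd q k z := by
  simp_rw [partialProd_succ_update]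
  rw [lintegral_const_mul _ (hm _ _), hq, mul_one]

lemma lmarginal_partialProd
    {q : (t : Fin T) → (Fin dz → ℝ) → (Fin (t : ℕ) → Fin dz → ℝ) → ℝ≥0∞}
    (hm : ∀ t h, Measurable fun x => q t x h) (hq : ∀ t h, ∫⁻ x, q t x h = 1)
    (hmj : Measurable (partialProd q T)) {k : ℕ} (hk : k ≤ T) :
    lmarginal (fun _ => volume) {t : Fin T | k ≤ t.1} (partialProd q T) = partialProd q k := by
  induction hk using Nat.decreasingInduction with
  | self =>
    rw [Finset.filter_false_of_mem (fun t _ => by have := t.2; omega), lmarginal_empty]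
  | of_succ k hk ih =>
    have : (Finset.univ.filter fun t : Fin T => k ≤ t.1) =
        insert ⟨k, hk⟩ (Finset.univ.filter fun t : Fin T => k + 1 ≤ t.1) := by
      ext t
      simp only [Finset.mem_filter, Finset.mem_univ, true_and, Finset.mem_insert, Fin.ext_iff]
      omega
    funext z
    rw [this, lmarginal_insert _ hmj (by simp), ih]
    exact lintegral_partialProd_update hm hq ⟨k, hk⟩ z

/-- A product of transition densities is a density. -/
lemma lintegral_prod_transition
    {q : (t : Fin T) → (Fin dz → ℝ) → (Fin (t : ℕ) → Fin dz → ℝ) → ℝ≥0∞}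
    (hm : ∀ t h, Measurable fun x => q t x h) (hq : ∀ t h, ∫⁻ x, q t x h = 1)
    (hmj : Measurable (partialProd q T)) : ∫⁻ z, partialProd q T z = 1 := by
  have h := lmarginal_partialProd hm hq hmj (Nat.zero_le T)
  rw [Finset.filter_true_of_mem (fun t _ => Nat.zero_le _), lmarginal_univ] at h
  have := congrFun h 0
  rwa [partialProd_zero] at this

lemma partialProd_eq_of_last
    {q q' : (t : Fin T) → (Fin dz → ℝ) → (Fin (t : ℕ) → Fin dz → ℝ) → ℝ≥0∞}
    (hm : ∀ t h, Measurable fun x => q t x h) (hq : ∀ t h, ∫⁻ x, q t x h = 1)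
    (hm' : ∀ t h, Measurable fun x => q' t x h) (hq' : ∀ t h, ∫⁻ x, q' t x h = 1)
    (h : partialProd q T = partialProd q' T) {k : ℕ} (hk : k ≤ T) :
    partialProd q k = partialProd q' k := by
  induction hk using Nat.decreasingInduction with
  | self => exact h
  | of_succ k hk ih =>
    funext z
    rw [← lintegral_partialProd_update hm hq ⟨k, hk⟩,
      ← lintegral_partialProd_update hm' hq' ⟨k, hk⟩]
    simp only [ih]

/-- No regularity in the past is needed: the approximating trajectory is built one time step at a
time, each new latent being chosen after its past is fixed, and this choice leaves the earlier
factors unchanged. -/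
lemma dense_prod_transition_ne_zero {R : Type*} [Zero R]
    {q : (t : Fin T) → (Fin dz → ℝ) → (Fin (t : ℕ) → Fin dz → ℝ) → R}
    (hd : ∀ t h, Dense {x | q t x h ≠ 0}) :
    Dense {z : Fin T → Fin dz → ℝ | ∀ t, q t (z t) (pastLatents z t) ≠ 0} := by
  rw [Metric.dense_iff]
  intro z₀ ε hε
  have key : ∀ k ≤ T, ∃ z ∈ Metric.ball z₀ ε,
      ∀ t : Fin T, t.1 < k → q t (z t) (pastLatents z t) ≠ 0 := by
    intro k
    induction k with
    | zero => exact fun _ => ⟨z₀, Metric.mem_ball_self hε, fun t ht => absurd ht (by omega)⟩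
    | succ k ih =>
      intro hk
      obtain ⟨z, hz, hzt⟩ := ih (by omega)
      let κ : Fin T := ⟨k, hk⟩
      obtain ⟨x, hx, hxq⟩ := Metric.dense_iff.mp (hd κ (pastLatents z κ)) (z₀ κ) ε hε
      refine ⟨Function.update z κ x, ?_, fun t ht => ?_⟩
      · rw [Metric.mem_ball, dist_pi_lt_iff hε] at hz ⊢
        intro t
        by_cases h : t = κ
        · subst h
          simpa using hx
        · simpa [Function.update_of_ne h] using hz t
      · have htκ : t ≤ κ := Nat.lt_succ_iff.mp ht
        rw [pastLatents_update_of_le _ _ htκ]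
        by_cases h : t = κ
        · subst h
          simpa using hxq
        · rw [Function.update_of_ne h]
          exact hzt t (lt_of_le_of_ne htκ h : t < κ)
  obtain ⟨z, hz, h⟩ := key T le_rfl
  exact ⟨z, hz, fun t => h t t.2⟩

lemma continuous_pastLatents (t : Fin T) :
    Continuous fun z : Fin T → Fin dz → ℝ => pastLatents z t := by
  unfold pastLatents
  fun_prop

lemma exists_eq_pastLatents (t : Fin T) (x : Fin dz → ℝ) (h : Fin (t : ℕ) → Fin dz → ℝ) :
    ∃ z : Fin T → Fin dz → ℝ, z t = x ∧ pastLatents z t = h := by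
  refine ⟨fun s => if hs : s.1 < t.1 then h ⟨s, hs⟩ else x, by simp, ?_⟩
  funext s
  simp [pastLatents]

/-- Continuous transition densities are determined by their product. -/
lemma transition_eq_of_prod_eq
    {q q' : (t : Fin T) → (Fin dz → ℝ) → (Fin (t : ℕ) → Fin dz → ℝ) → ℝ}
    (hc : ∀ t : Fin T, Continuous fun y : (Fin dz → ℝ) × (Fin (t : ℕ) → Fin dz → ℝ) => q t y.1 y.2)
    (hc' : ∀ t : Fin T, Continuous fun y : (Fin dz → ℝ) × (Fin (t : ℕ) → Fin dz → ℝ) => q' t y.1 y.2)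
    (h0 : ∀ t x h, 0 ≤ q t x h) (h0' : ∀ t x h, 0 ≤ q' t x h)
    (h1 : ∀ t h, ∫⁻ x, ENNReal.ofReal (q t x h) = 1)
    (h1' : ∀ t h, ∫⁻ x, ENNReal.ofReal (q' t x h) = 1)
    (hd : ∀ t h, Dense {x | q t x h ≠ 0})
    (heq : ∀ z : Fin T → Fin dz → ℝ,
      ∏ t, q t (z t) (pastLatents z t) = ∏ t, q' t (z t) (pastLatents z t))
    (t : Fin T) (x : Fin dz → ℝ) (h : Fin (t : ℕ) → Fin dz → ℝ) : q t x h = q' t x h := by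
  obtain ⟨z, rfl, rfl⟩ := exists_eq_pastLatents t x h
  have hz := (continuous_apply (A := fun _ : Fin T => Fin dz → ℝ) t).prodMk
    (continuous_pastLatents t)
  -- By continuity in the whole trajectory it suffices to compare where no factor of `q` vanishes.
  -- There the `t`-th factor is a quotient of consecutive partial products, and these agree for `q`
  -- and `q'`.
  refine congrFun (Continuous.ext_on (dense_prod_transition_ne_zero hd) ((hc t).comp hz)
    ((hc' t).comp hz) fun z hz => ?_) z
  have hm : ∀ t h, Measurable fun x => ENNReal.ofReal (q t x h) := fun t h =>
    ((hc t).comp (by fun_prop : Continuous fun x => (x, h))).measurable.ennreal_ofReal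
  have hm' : ∀ t h, Measurable fun x => ENNReal.ofReal (q' t x h) := fun t h =>
    ((hc' t).comp (by fun_prop : Continuous fun x => (x, h))).measurable.ennreal_ofReal
  have hlast : partialProd (fun (t : Fin T) x h => ENNReal.ofReal (q t x h)) T =
      partialProd (fun (t : Fin T) x h => ENNReal.ofReal (q' t x h)) T := by
    funext z
    rw [partialProd_last, partialProd_last, ← ENNReal.ofReal_prod_of_nonneg fun _ _ => h0 _ _ _,
      ← ENNReal.ofReal_prod_of_nonneg fun _ _ => h0' _ _ _, heq]
  have hk := congrFun (partialProd_eq_of_last hm h1 hm' h1' hlast t.2.le) z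
  have hk1 := congrFun (partialProd_eq_of_last hm h1 hm' h1' hlast (k := t + 1) t.2) z
  rw [partialProd_succ, partialProd_succ, ← hk] at hk1
  have hne : partialProd (fun (t : Fin T) x h => ENNReal.ofReal (q t x h)) t z ≠ 0 :=
    Finset.prod_ne_zero_iff.mpr fun s _ =>
      (ENNReal.ofReal_pos.mpr (lt_of_le_of_ne (h0 _ _ _) (hz s).symm)).ne'
  have htop : partialProd (fun (t : Fin T) x h => ENNReal.ofReal (q t x h)) t z ≠ ∞ :=
    ENNReal.prod_ne_top fun _ _ => ENNReal.ofReal_ne_top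
  exact (ENNReal.ofReal_eq_ofReal_iff (h0 _ _ _) (h0' _ _ _)).mp
    ((ENNReal.mul_right_inj hne htop).mp hk1)

end Sequential

/-! ### Consequences of the assumptions on a model -/

namespace Model

variable {dz dx da T : ℕ} {θ θ' : Model dz dx da T} {A : Set (Fin da → ℝ)}

lemma CondIndep.dense_mechanism_ne_zero (hind : θ.CondIndep A) (t : Fin T) (i : Fin dz)
    (h : Fin (t : ℕ) → Fin dz → ℝ) {a : Fin ((t : ℕ) + 1) → Fin da → ℝ} (ha : ∀ s, a s ∈ A) :
    Dense {x | θ.mechanism t i x h a ≠ 0} := by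
  have hs := (hind t h a ha).2.2.2.2 i
  intro x
  rw [mem_closure_iff_nhds]
  intro U hU
  obtain ⟨V, hVU, hV, hxV⟩ := mem_nhds_iff.mp hU
  have hpos := (Measure.mem_support_iff_forall x).mp (hs ▸ Set.mem_univ x) V (hV.mem_nhds hxV)
  rw [withDensity_apply _ hV.measurableSet] at hpos
  by_contra hne
  refine hpos.ne' (setLIntegral_eq_zero hV.measurableSet fun y hy => ?_)
  by_contra hy0
  exact hne ⟨y, hVU hy, fun h0 => hy0 (by simp [h0])⟩

lemma CondIndep.dense_p_ne_zero (hind : θ.CondIndep A) (t : Fin T)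
    (h : Fin (t : ℕ) → Fin dz → ℝ) {a : Fin ((t : ℕ) + 1) → Fin da → ℝ} (ha : ∀ s, a s ∈ A) :
    Dense {z | θ.p t z h a ≠ 0} := by
  refine (dense_pi Set.univ fun i _ => hind.dense_mechanism_ne_zero t i h ha).mono fun z hz => ?_
  rw [Set.mem_ofPred_eq, (hind t h a ha).2.2.2.1 z]
  exact Finset.prod_ne_zero_iff.mpr fun i _ => hz i (Set.mem_univ i)

lemma CondIndep.contDiff_p (hind : θ.CondIndep A) (hsmooth : θ.SmoothTransition A) (t : Fin T)
    {a : Fin ((t : ℕ) + 1) → Fin da → ℝ} (ha : ∀ s, a s ∈ A) :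
    ContDiff ℝ 2 fun y : (Fin dz → ℝ) × (Fin (t : ℕ) → Fin dz → ℝ) => θ.p t y.1 y.2 a := by
  simp only [fun y : (Fin dz → ℝ) × (Fin (t : ℕ) → Fin dz → ℝ) =>
    (hind t y.2 a ha).2.2.2.1 y.1]
  refine contDiff_prod fun i _ => ?_
  exact (hsmooth t i a ha).comp
    (((contDiff_apply ℝ ℝ i).comp contDiff_fst).prodMk contDiff_snd)

lemma CondIndep.continuous_p (hind : θ.CondIndep A) (hsmooth : θ.SmoothTransition A) (t : Fin T)
    {a : Fin ((t : ℕ) + 1) → Fin da → ℝ} (ha : ∀ s, a s ∈ A) :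
    Continuous fun y : (Fin dz → ℝ) × (Fin (t : ℕ) → Fin dz → ℝ) => θ.p t y.1 y.2 a :=
  (hind.contDiff_p hsmooth t ha).continuous

lemma CondIndep.lintegral_p (hind : θ.CondIndep A) (t : Fin T)
    (h : Fin (t : ℕ) → Fin dz → ℝ) {a : Fin ((t : ℕ) + 1) → Fin da → ℝ} (ha : ∀ s, a s ∈ A) :
    ∫⁻ z, ENNReal.ofReal (θ.p t z h a) = 1 := by
  obtain ⟨h0, hi, h1, -⟩ := hind t h a ha
  rw [← ofReal_integral_eq_lintegral_ofReal hi (.of_forall h0), h1, ENNReal.ofReal_one]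

lemma pastAux_mem {a : Fin T → Fin da → ℝ} (ha : ∀ s, a s ∈ A) (t : Fin T) (s) :
    pastAux a t s ∈ A := ha _

/-- The density of the latents. -/
def jointDensity (θ : Model dz dx da T) (a : Fin T → Fin da → ℝ) (z : Fin T → Fin dz → ℝ) : ℝ :=
  ∏ t, θ.p t (z t) (pastLatents z t) (pastAux a t)

lemma latentLaw_eq (θ : Model dz dx da T) (a : Fin T → Fin da → ℝ) :
    θ.latentLaw a = volume.withDensity fun z => ENNReal.ofReal (θ.jointDensity a z) := rfl

lemma CondIndep.jointDensity_nonneg (hind : θ.CondIndep A) {a : Fin T → Fin da → ℝ}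
    (ha : ∀ s, a s ∈ A) (z : Fin T → Fin dz → ℝ) : 0 ≤ θ.jointDensity a z :=
  Finset.prod_nonneg fun t _ => (hind t _ _ (pastAux_mem ha t)).1 _

lemma CondIndep.continuous_jointDensity (hind : θ.CondIndep A) (hsmooth : θ.SmoothTransition A)
    {a : Fin T → Fin da → ℝ} (ha : ∀ s, a s ∈ A) : Continuous (θ.jointDensity a) :=
  continuous_finsetProd _ fun t _ => (hind.continuous_p hsmooth t (pastAux_mem ha t)).comp
    ((continuous_apply (A := fun _ : Fin T => Fin dz → ℝ) t).prodMk (continuous_pastLatents t))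

lemma CondIndep.isProbabilityMeasure_latentLaw (hind : θ.CondIndep A)
    (hsmooth : θ.SmoothTransition A) {a : Fin T → Fin da → ℝ} (ha : ∀ s, a s ∈ A) :
    IsProbabilityMeasure (θ.latentLaw a) := by
  have hp : partialProd (fun t x h => ENNReal.ofReal (θ.p t x h (pastAux a t))) T =
      fun z => ENNReal.ofReal (θ.jointDensity a z) := by
    funext z
    rw [partialProd_last, jointDensity,
      ENNReal.ofReal_prod_of_nonneg fun t _ => (hind t _ _ (pastAux_mem ha t)).1 _]
  refine ⟨?_⟩
  rw [latentLaw_eq, withDensity_apply _ MeasurableSet.univ, Measure.restrict_univ, ← hp]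
  refine lintegral_prod_transition (fun t h => ?_)
    (fun t h => hind.lintegral_p t h (pastAux_mem ha t)) ?_
  · exact ((hind.continuous_p hsmooth t (pastAux_mem ha t)).comp
      (by fun_prop : Continuous fun x => (x, h))).measurable.ennreal_ofReal
  · rw [hp]
    exact (hind.continuous_jointDensity hsmooth ha).measurable.ennreal_ofReal

/-- The joint density is continuous and nonzero on a dense set, so it is positive on a nonempty open
part of `U`, which has positive Lebesgue measure. -/
lemma CondIndep.latentLaw_ne_zero_of_isOpen (hind : θ.CondIndep A)
    (hsmooth : θ.SmoothTransition A) {a : Fin T → Fin da → ℝ} (ha : ∀ s, a s ∈ A)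
    {U : Set (Fin T → Fin dz → ℝ)} (hU : IsOpen U) (hne : U.Nonempty) :
    θ.latentLaw a U ≠ 0 := by
  have hc := hind.continuous_jointDensity hsmooth ha
  obtain ⟨z, hzU, hz⟩ := (dense_prod_transition_ne_zero
    (q := fun t x h => θ.p t x h (pastAux a t))
    fun t h => hind.dense_p_ne_zero t h (pastAux_mem ha t)).inter_open_nonempty U hU hne
  have hz : z ∈ U ∩ {z | θ.jointDensity a z ≠ 0} :=
    ⟨hzU, Finset.prod_ne_zero_iff.mpr fun t _ => hz t⟩
  have hO : IsOpen (U ∩ {z | θ.jointDensity a z ≠ 0}) :=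
    hU.inter (isOpen_ne_fun hc continuous_const)
  have hm := hc.measurable.ennreal_ofReal
  rw [latentLaw_eq, Ne, withDensity_apply_eq_zero hm, ← Ne]
  refine (hO.measure_pos volume ⟨z, hz⟩).ne' ∘ fun h => measure_mono_null (fun y hy => ?_) h
  refine ⟨?_, hy.1⟩
  exact (ENNReal.ofReal_pos.mpr (lt_of_le_of_ne (hind.jointDensity_nonneg ha y) (Ne.symm hy.2))).ne'

/-- The images of the decoders agree when the noiseless observations have the same law. -/
lemma range_subset_of_map_latentLaw_eq (hT : 0 < T) (hf : Continuous θ.f) (hf' : Continuous θ'.f)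
    (hcl : IsClosed (Set.range θ.f)) (hind' : θ'.CondIndep A)
    (hsmooth' : θ'.SmoothTransition A) {a : Fin T → Fin da → ℝ} (ha : ∀ s, a s ∈ A)
    (h : ((θ.latentLaw a).map fun z t => θ.f (z t)) =
      (θ'.latentLaw a).map fun z t => θ'.f (z t)) :
    Set.range θ'.f ⊆ Set.range θ.f := by
  rintro _ ⟨z₀, rfl⟩
  by_contra hz₀
  let τ : Fin T := ⟨0, hT⟩
  -- The event that the first observation misses the closed image of `θ.f`. It is open and null for
  -- `θ`, but it would have positive mass for `θ'`.
  let V : Set (Fin T → Fin dx → ℝ) := {y | y τ ∈ (Set.range θ.f)ᶜ}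
  have hV : IsOpen V := hcl.isOpen_compl.preimage (continuous_apply τ)
  have hF : Continuous fun (z : Fin T → Fin dz → ℝ) t => θ.f (z t) := by fun_prop
  have hF' : Continuous fun (z : Fin T → Fin dz → ℝ) t => θ'.f (z t) := by fun_prop
  have hVm := congrArg (fun μ => μ V) h
  simp only [Measure.map_apply hF.measurable hV.measurableSet,
    Measure.map_apply hF'.measurable hV.measurableSet] at hVm
  have hempty : (fun (z : Fin T → Fin dz → ℝ) t => θ.f (z t)) ⁻¹' V = ∅ :=
    Set.eq_empty_of_forall_notMem fun z hz => hz ⟨z τ, rfl⟩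
  rw [hempty, measure_empty] at hVm
  exact hind'.latentLaw_ne_zero_of_isOpen hsmooth' ha (hV.preimage hF') ⟨fun _ => z₀, hz₀⟩ hVm.symm

end Model

/-! ### The entanglement map -/

section Entanglement

variable {m n : ℕ} {f f' : (Fin m → ℝ) → (Fin n → ℝ)}

lemma apply_entanglementMap (hr : Set.range f' ⊆ Set.range f) (z : Fin m → ℝ) :
    f (entanglementMap f f' z) = f' z :=
  Function.invFun_eq (hr ⟨z, rfl⟩)

lemma entanglementMap_entanglementMap (hf' : Function.Injective f')
    (hr : Set.range f = Set.range f') (z : Fin m → ℝ) :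
    entanglementMap f' f (entanglementMap f f' z) = z :=
  hf' (by rw [apply_entanglementMap hr.subset, apply_entanglementMap hr.symm.subset])

lemma contDiff_entanglementMap (hf : IsDiffeoOntoImage f) (hf' : IsDiffeoOntoImage f')
    (hr : Set.range f' ⊆ Set.range f) : ContDiff ℝ 1 (entanglementMap f f') := by
  obtain ⟨-, -, U, g, hU, hUr, hg, hgf⟩ := hf
  have : entanglementMap f f' = g ∘ f' := by
    funext z
    rw [Function.comp_apply, ← apply_entanglementMap hr, hgf]
  rw [this]
  exact hg.comp_contDiff hf'.1 fun z => hUr (hr ⟨z, rfl⟩)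

lemma isDiffeo_of_inverse {v w : (Fin m → ℝ) → (Fin m → ℝ)} (hv : ContDiff ℝ 1 v)
    (hw : ContDiff ℝ 1 w) (hwv : Function.LeftInverse w v) (hvw : Function.RightInverse w v) :
    IsDiffeo v :=
  ⟨⟨hv, hwv.injective, Set.univ, w, isOpen_univ, Set.subset_univ _, hw.contDiffOn, hwv⟩,
    hvw.surjective⟩

lemma isDiffeo_entanglementMap (hf : IsDiffeoOntoImage f) (hf' : IsDiffeoOntoImage f')
    (hr : Set.range f = Set.range f') : IsDiffeo (entanglementMap f f') :=
  isDiffeo_of_inverse (contDiff_entanglementMap hf hf' hr.symm.subset)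
    (contDiff_entanglementMap hf' hf hr.subset) (entanglementMap_entanglementMap hf'.2.1 hr)
    (entanglementMap_entanglementMap hf.2.1 hr.symm)

lemma IsDiffeo.det_fderiv_ne_zero {v : (Fin m → ℝ) → (Fin m → ℝ)} (hv : IsDiffeo v)
    (z : Fin m → ℝ) : (fderiv ℝ v z).det ≠ 0 := by
  obtain ⟨⟨hv1, -, U, g, hU, hUr, hg, hgv⟩, -⟩ := hv
  have h1 : HasFDerivAt v (fderiv ℝ v z) z := (hv1.differentiable one_ne_zero z).hasFDerivAt
  have h2 : HasFDerivAt g (fderiv ℝ g (v z)) (v z) :=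
    ((hg.contDiffAt (hU.mem_nhds (hUr ⟨z, rfl⟩))).differentiableAt one_ne_zero).hasFDerivAt
  have h3 : (fderiv ℝ g (v z)).comp (fderiv ℝ v z) = ContinuousLinearMap.id ℝ _ :=
    (h2.comp z h1).unique (by simpa [funext hgv, Function.comp_def] using hasFDerivAt_id (𝕜 := ℝ) z)
  intro h0
  have h4 := congrArg (fun L : (Fin m → ℝ) →L[ℝ] (Fin m → ℝ) => L.det) h3
  simp only [ContinuousLinearMap.det, ContinuousLinearMap.toLinearMap_comp,
    LinearMap.det_comp] at h4
  rw [ContinuousLinearMap.det] at h0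
  rw [h0] at h4
  simp at h4

lemma IsDiffeo.continuous_det_fderiv {v : (Fin m → ℝ) → (Fin m → ℝ)} (hv : IsDiffeo v) :
    Continuous fun z => (fderiv ℝ v z).det :=
  ContinuousLinearMap.continuous_det.comp (hv.1.1.continuous_fderiv one_ne_zero)

lemma IsDiffeo.lintegral_comp_mul {v : (Fin m → ℝ) → (Fin m → ℝ)} (hv : IsDiffeo v)
    (g : (Fin m → ℝ) → ℝ≥0∞) :
    ∫⁻ z, ENNReal.ofReal |(fderiv ℝ v z).det| * g (v z) = ∫⁻ z, g z := by
  have := lintegral_image_eq_lintegral_abs_det_fderiv_mul volume MeasurableSet.univ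
    (fun z _ => (hv.1.1.differentiable one_ne_zero z).hasFDerivAt.hasFDerivWithinAt)
    hv.1.2.1.injOn g
  rw [Set.image_univ, hv.2.range_eq] at this
  simpa using this.symm

end Entanglement

/-! ### Equivalence up to diffeomorphism -/

lemma map_pi_injective {ι X Y : Type*} {f : X → Y} (hf : Function.Injective f) :
    Function.Injective fun (z : ι → X) t => f (z t) :=
  fun _ _ h => funext fun t => hf (congrFun h t)

/-- A coordinatewise diffeomorphism and its derivative. -/
lemma hasFDerivAt_map_pi {m T : ℕ} {v : (Fin m → ℝ) → (Fin m → ℝ)} (hv : Differentiable ℝ v)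
    (z : Fin T → Fin m → ℝ) :
    HasFDerivAt (fun (z : Fin T → Fin m → ℝ) t => v (z t))
      (ContinuousLinearMap.pi fun t => (fderiv ℝ v (z t)).comp (ContinuousLinearMap.proj t)) z :=
  hasFDerivAt_pi.mpr fun t => (hv (z t)).hasFDerivAt.comp z (hasFDerivAt_apply t z)

/-- If the density `Q'` is sent to the density `Q` by the coordinatewise diffeomorphism given by
`v`, then the two are related by the change of variables formula. -/
lemma density_eq_of_map_eq {m T : ℕ} {v : (Fin m → ℝ) → (Fin m → ℝ)} (hv : IsDiffeo v)
    {Q Q' : (Fin T → Fin m → ℝ) → ℝ} (hQ : Continuous Q) (hQ' : Continuous Q')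
    (hQ0 : ∀ z, 0 ≤ Q z) (hQ0' : ∀ z, 0 ≤ Q' z)
    (h : (volume.withDensity fun z => ENNReal.ofReal (Q z)) =
      (volume.withDensity fun z => ENNReal.ofReal (Q' z)).map fun z t => v (z t))
    (z : Fin T → Fin m → ℝ) :
    Q' z = Q (fun t => v (z t)) * ∏ t, |(fderiv ℝ v (z t)).det| := by
  have hvc : Continuous v := hv.1.1.continuous
  have hV : Continuous fun (z : Fin T → Fin m → ℝ) t => v (z t) := by fun_prop
  have hVi := map_pi_injective (ι := Fin T) hv.1.2.1
  have hVe := hV.measurableEmbedding hVi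
  have hJ : Continuous fun z : Fin T → Fin m → ℝ =>
      Q (fun t => v (z t)) * ∏ t, |(fderiv ℝ v (z t)).det| :=
    (hQ.comp hV).mul (continuous_finsetProd _ fun t _ =>
      (hv.continuous_det_fderiv.comp (continuous_apply t)).abs)
  have hwd : (volume.withDensity fun z => ENNReal.ofReal (Q' z)) = volume.withDensity fun z =>
      ENNReal.ofReal (Q (fun t => v (z t)) * ∏ t, |(fderiv ℝ v (z t)).det|) := by
    -- Evaluating the hypothesis on the image of `s` returns `s` on the right, by injectivity, and
    -- allows the change of variables on the left.
    ext s hs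
    have hs' := hVe.measurableSet_image' hs
    have h1 := congrArg (fun μ => μ ((fun (z : Fin T → Fin m → ℝ) t => v (z t)) '' s)) h
    simp only [hVe.map_apply, Set.preimage_image_eq _ hVi] at h1
    rw [← h1, withDensity_apply _ hs', withDensity_apply _ hs,
      lintegral_image_eq_lintegral_abs_det_fderiv_mul volume hs (fun z _ =>
        (hasFDerivAt_map_pi (hv.1.1.differentiable one_ne_zero) z).hasFDerivWithinAt) hVi.injOn]
    refine lintegral_congr fun z => ?_
    rw [ContinuousLinearMap.det_pi, Finset.abs_prod, mul_comm,
      ENNReal.ofReal_mul (hQ0 _)]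
  -- Equal measures give equality of densities almost everywhere; continuity makes it hold at every
  -- point.
  have hae := (withDensity_eq_iff_of_sigmaFinite hQ'.measurable.ennreal_ofReal.aemeasurable
    hJ.measurable.ennreal_ofReal.aemeasurable).mp hwd
  have heq := congrFun ((Continuous.ae_eq_iff_eq volume
    (ENNReal.continuous_ofReal.comp hQ') (ENNReal.continuous_ofReal.comp hJ)).mp hae) z
  exact (ENNReal.ofReal_eq_ofReal_iff (hQ0' z) (mul_nonneg (hQ0 _)
    (Finset.prod_nonneg fun _ _ => abs_nonneg _))).mp heq

namespace Model

variable {dz dx da T : ℕ} {θ θ' : Model dz dx da T} {A : Set (Fin da → ℝ)}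

lemma exists_eq_pastAux (t : Fin T) {a : Fin ((t : ℕ) + 1) → Fin da → ℝ} (ha : ∀ s, a s ∈ A) :
    ∃ b : Fin T → Fin da → ℝ, (∀ s, b s ∈ A) ∧ pastAux b t = a := by
  -- The filler `a 0` is never read by `pastAux b t`, but it keeps the whole sequence in `A`.
  refine ⟨fun s => if hs : s.1 < t.1 + 1 then a ⟨s, hs⟩ else a 0, fun s => ?_, ?_⟩
  · dsimp only
    split_ifs
    exacts [ha _, ha _]
  · funext s
    exact dif_pos s.2

/-- Observationally equivalent models are equivalent up to diffeomorphism. -/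
theorem diffEquiv_of_obsEquiv (hT : 0 < T) {σ2 : ℝ≥0} (hA : A.Nonempty)
    (hobs : θ.ObservationModel) (hobs' : θ'.ObservationModel)
    (hind : θ.CondIndep A) (hind' : θ'.CondIndep A)
    (hsmooth : θ.SmoothTransition A) (hsmooth' : θ'.SmoothTransition A)
    (hequiv : ObsEquiv σ2 A θ θ') : DiffEquiv A θ θ' := by
  obtain ⟨-, hf, hcl⟩ := hobs
  obtain ⟨-, hf', hcl'⟩ := hobs'
  have hlaw : ∀ a : Fin T → Fin da → ℝ, (∀ s, a s ∈ A) →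
      ((θ.latentLaw a).map fun z t => θ.f (z t)) =
        (θ'.latentLaw a).map fun z t => θ'.f (z t) := fun a ha => by
    have := hind.isProbabilityMeasure_latentLaw hsmooth ha
    have := hind'.isProbabilityMeasure_latentLaw hsmooth' ha
    exact map_latentLaw_eq hf.1.continuous.measurable hf'.1.continuous.measurable (hequiv a ha)
  obtain ⟨a₀, ha₀⟩ := hA
  have hr : Set.range θ.f = Set.range θ'.f :=
    (range_subset_of_map_latentLaw_eq hT hf'.1.continuous hf.1.continuous hcl' hind hsmooth
      (fun _ => ha₀) (hlaw (fun _ => a₀) fun _ => ha₀).symm).antisymm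
    (range_subset_of_map_latentLaw_eq hT hf.1.continuous hf'.1.continuous hcl hind' hsmooth'
      (fun _ => ha₀) (hlaw (fun _ => a₀) fun _ => ha₀))
  have hv := isDiffeo_entanglementMap hf hf' hr
  have hfv := apply_entanglementMap hr.symm.subset
  refine ⟨hr, hv, fun t a ha z h => ?_⟩
  generalize entanglementMap θ.f θ'.f = v at hv hfv
  obtain ⟨b, hb, rfl⟩ := exists_eq_pastAux t ha
  have hvc : Continuous v := hv.1.1.continuous
  have hmap : θ.latentLaw b = (θ'.latentLaw b).map fun z t => v (z t) := by
    have hfc := hf.1.continuous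
    have he := Continuous.measurableEmbedding
      (by fun_prop : Continuous fun (z : Fin T → Fin dz → ℝ) t => θ.f (z t))
      (map_pi_injective hf.2.1)
    have h1 : ((θ.latentLaw b).map fun z t => θ.f (z t)) =
        ((θ'.latentLaw b).map fun z t => v (z t)).map fun z t => θ.f (z t) := by
      rw [hlaw b hb, Measure.map_map he.measurable
        (by fun_prop : Continuous fun (z : Fin T → Fin dz → ℝ) t => v (z t)).measurable]
      congr 1
      funext z t
      exact (hfv _).symm
    -- The coordinatewise decoder is an embedding, so it cancels from both pushforwards.
    rw [← he.comap_map (θ.latentLaw b), h1, he.comap_map]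
  have hjoint := density_eq_of_map_eq hv (hind.continuous_jointDensity hsmooth hb)
    (hind'.continuous_jointDensity hsmooth' hb) (hind.jointDensity_nonneg hb)
    (hind'.jointDensity_nonneg hb) (by rw [← latentLaw_eq, ← latentLaw_eq, hmap])
  -- The transported densities of `θ` form a second family of transitions: each integrates to one by
  -- substituting `v` in the present variable alone, with the past fixed.
  refine transition_eq_of_prod_eq (q := fun t z h => θ'.p t z h (pastAux b t))
    (q' := fun t z h => θ.p t (v z) (fun s => v (h s)) (pastAux b t) * |(fderiv ℝ v z).det|)
    (fun t => hind'.continuous_p hsmooth' t (pastAux_mem hb t)) (fun t => ?_)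
    (fun t z h => (hind' t h _ (pastAux_mem hb t)).1 z)
    (fun t z h => mul_nonneg ((hind t _ _ (pastAux_mem hb t)).1 _) (abs_nonneg _))
    (fun t h => hind'.lintegral_p t h (pastAux_mem hb t)) (fun t h => ?_)
    (fun t h => hind'.dense_p_ne_zero t h (pastAux_mem hb t)) (fun z => ?_) t z h
  · have hvv : Continuous fun y : (Fin dz → ℝ) × (Fin (t : ℕ) → Fin dz → ℝ) =>
        (v y.1, fun s => v (y.2 s)) := by fun_prop
    exact ((hind.continuous_p hsmooth t (pastAux_mem hb t)).comp hvv).mul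
      (hv.continuous_det_fderiv.comp continuous_fst).abs
  · have := hv.lintegral_comp_mul
      fun z => ENNReal.ofReal (θ.p t z (fun s => v (h s)) (pastAux b t))
    rw [hind.lintegral_p t _ (pastAux_mem hb t)] at this
    rw [← this]
    refine lintegral_congr fun z => ?_
    rw [mul_comm, ENNReal.ofReal_mul (abs_nonneg _)]
  · have := hjoint z
    rw [jointDensity, jointDensity, ← Finset.prod_mul_distrib] at this
    exact this

end Model

/-! ### Mixed second derivatives -/

section Mixed

variable {E H : Type*} [NormedAddCommGroup E] [NormedSpace ℝ E] [NormedAddCommGroup H]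
  [NormedSpace ℝ H]

/-- The mixed second derivative of `(x, y) ↦ F (v x, V y) + ℓ x`, first in `y`, then in `x`. -/
lemma hasFDerivAt_fderiv_right {F F' : E × H → ℝ} {v : E → E} {V : H → H} {ℓ : E → ℝ} {x₀ : E}
    {y₀ : H} {v' : E →L[ℝ] E} {V' : H →L[ℝ] H} (hF : ContDiffAt ℝ 2 F (v x₀, V y₀))
    (hv : HasFDerivAt v v' x₀) (hV : HasFDerivAt V V' y₀)
    (hF' : ∀ᶠ x in 𝓝 x₀, ∀ᶠ y in 𝓝 y₀, F' (x, y) = F (v x, V y) + ℓ x) (w : H) :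
    HasFDerivAt (fun x => fderiv ℝ (fun y => F' (x, y)) y₀ w)
      ((fderiv ℝ (fderiv ℝ F) (v x₀, V y₀)).flip (0, V' w) ∘L
        (ContinuousLinearMap.inl ℝ E H ∘L v')) x₀ := by
  have h1 : HasFDerivAt (fun x => fderiv ℝ F (v x, V y₀) (0, V' w))
      ((fderiv ℝ (fderiv ℝ F) (v x₀, V y₀)).flip (0, V' w) ∘L
        (ContinuousLinearMap.inl ℝ E H ∘L v')) x₀ := by
    have hd : HasFDerivAt (fderiv ℝ F) (fderiv ℝ (fderiv ℝ F) (v x₀, V y₀)) (v x₀, V y₀) :=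
      ((hF.fderiv_right (m := 1) (by norm_num)).differentiableAt one_ne_zero).hasFDerivAt
    have hp : HasFDerivAt (fun x => (v x, V y₀)) (ContinuousLinearMap.inl ℝ E H ∘L v') x₀ :=
      (hasFDerivAt_prodMk_left (v x₀) (V y₀)).comp x₀ hv
    have := (hd.comp x₀ hp).clm_apply (hasFDerivAt_const ((0 : E), V' w) x₀)
    refine this.congr_fderiv ?_
    ext u
    simp
  refine h1.congr_of_eventuallyEq ?_
  have hdiff : ∀ᶠ x in 𝓝 x₀, DifferentiableAt ℝ F (v x, V y₀) := by
    have hc : ContinuousAt (fun x => (v x, V y₀)) x₀ := hv.continuousAt.prodMk continuousAt_const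
    filter_upwards [hc.eventually (hF.eventually (by simp))] with x hx
    exact hx.differentiableAt two_ne_zero
  filter_upwards [hdiff, hF'] with x hx hxF
  -- Differentiating in `y` first removes `ℓ x`, so `ℓ` need not be differentiable. This matters
  -- because `ℓ` will be `log |det Dv|` with `v` only `C¹`.
  have h2 : HasFDerivAt (fun y => F (v x, V y) + ℓ x)
      (fderiv ℝ F (v x, V y₀) ∘L (ContinuousLinearMap.inr ℝ E H ∘L V')) y₀ :=
    (hx.hasFDerivAt.comp y₀ ((hasFDerivAt_prodMk_right (v x) (V y₀)).comp y₀ hV)).add_const _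
  rw [(h2.congr_of_eventuallyEq hxF).fderiv]
  simp

/-- `hessianLog` differentiates in the present before the past; symmetry of the second derivative
reconciles this with the order used in `hasFDerivAt_fderiv_right`. -/
lemma fderiv_fderiv_left {F : E × H → ℝ} {x₀ : E} {y₀ : H} (hF : ContDiffAt ℝ 2 F (x₀, y₀))
    (u : E) (w : H) :
    fderiv ℝ (fun y => fderiv ℝ (fun x => F (x, y)) x₀ u) y₀ w =
      fderiv ℝ (fderiv ℝ F) (x₀, y₀) (u, 0) (0, w) := by
  have hd : HasFDerivAt (fderiv ℝ F) (fderiv ℝ (fderiv ℝ F) (x₀, y₀)) (x₀, y₀) :=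
    ((hF.fderiv_right (m := 1) (by norm_num)).differentiableAt one_ne_zero).hasFDerivAt
  have h1 := (hd.comp y₀ (hasFDerivAt_prodMk_right x₀ y₀)).clm_apply
    (hasFDerivAt_const (u, (0 : H)) y₀)
  have hc : ContinuousAt (fun y => (x₀, y)) y₀ := by fun_prop
  have h2 : (fun y => fderiv ℝ (fun x => F (x, y)) x₀ u) =ᶠ[𝓝 y₀]
      fun y => fderiv ℝ F (x₀, y) (u, 0) := by
    filter_upwards [hc.eventually (hF.eventually (by simp))] with y hy
    have h3 : HasFDerivAt (fun x => F (x, y))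
        (fderiv ℝ F (x₀, y) ∘L ContinuousLinearMap.inl ℝ E H) x₀ :=
      HasFDerivAt.comp x₀ (hy.differentiableAt two_ne_zero).hasFDerivAt
        (hasFDerivAt_prodMk_left x₀ y)
    rw [h3.fderiv]
    simp
  rw [(h1.congr_of_eventuallyEq h2).fderiv]
  have hsymm : IsSymmSndFDerivAt ℝ F (x₀, y₀) := hF.isSymmSndFDerivAt (by simp)
  simpa using hsymm (0, w) (u, 0)

lemma hasFDerivAt_apply_eq_zero_of_const {f : E → ℝ} {f' : E →L[ℝ] ℝ} {x u : E}
    (hf : HasFDerivAt f f' x) (h : ∀ᶠ s : ℝ in 𝓝 0, f (x + s • u) = f x) : f' u = 0 := by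
  have h1 : HasDerivAt (fun s : ℝ => f (x + s • u)) (f' u) 0 := hf.hasLineDerivAt u
  exact h1.unique ((hasDerivAt_const (0 : ℝ) (f x)).congr_of_eventuallyEq h)

lemma fderiv_apply_eq_zero_of_const {f : E → ℝ} {x u : E}
    (h : ∀ s : ℝ, f (x + s • u) = f x) : fderiv ℝ f x u = 0 := by
  by_cases hf : DifferentiableAt ℝ f x
  · exact hasFDerivAt_apply_eq_zero_of_const hf.hasFDerivAt
      (.of_forall h)
  · simp [fderiv_zero_of_not_differentiableAt hf]

end Mixed

/-! ### The Hessians of the log-densities -/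

lemma bilin_apply_eq_sum {m : ℕ} (β : (Fin m → ℝ) →L[ℝ] (Fin m → ℝ) →L[ℝ] ℝ) (a b : Fin m → ℝ) :
    β a b = ∑ k, ∑ l, a k * β (Pi.single k 1) (Pi.single l 1) * b l := by
  conv_lhs => rw [pi_eq_sum_univ' a, pi_eq_sum_univ' b]
  simp only [map_sum, map_smul, sum_apply, smul_apply,
    smul_eq_mul, Finset.mul_sum]
  rw [Finset.sum_comm]
  refine Finset.sum_congr rfl fun k _ => Finset.sum_congr rfl fun l _ => ?_
  ring

namespace Model

variable {dz dx da T : ℕ} {θ θ' : Model dz dx da T} {A : Set (Fin da → ℝ)}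

lemma CondIndep.contDiffAt_log_p (hind : θ.CondIndep A) (hsmooth : θ.SmoothTransition A)
    (t : Fin T) {a : Fin ((t : ℕ) + 1) → Fin da → ℝ} (ha : ∀ s, a s ∈ A) {z : Fin dz → ℝ}
    {h : Fin (t : ℕ) → Fin dz → ℝ} (hp : θ.p t z h a ≠ 0) :
    ContDiffAt ℝ 2 (fun y : (Fin dz → ℝ) × (Fin (t : ℕ) → Fin dz → ℝ) =>
      Real.log (θ.p t y.1 y.2 a)) (z, h) :=
  (hind.contDiff_p hsmooth t ha).contDiffAt.log hp

/-- The Markov property makes the derivative of `log p` with respect to `z_j^τ` locally constant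
in `z_i^t` when `j` is not a parent of `i`. -/
lemma eventually_fderiv_log_p_eq (hind : θ.CondIndep A) (hmarkov : θ.Markov A)
    (hsmooth : θ.SmoothTransition A) (t : Fin T) (τ : Fin (t : ℕ))
    {a : Fin ((t : ℕ) + 1) → Fin da → ℝ} (ha : ∀ s, a s ∈ A) {z : Fin dz → ℝ}
    {h : Fin (t : ℕ) → Fin dz → ℝ} (hp : θ.p t z h a ≠ 0) {i j : Fin dz}
    (hG : θ.Gz i j = false) :
    ∀ᶠ s : ℝ in 𝓝 0,
      fderiv ℝ (fun h' => Real.log (θ.p t (z + s • Pi.single i 1) h' a)) h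
          (Pi.single τ (Pi.single j 1)) =
        fderiv ℝ (fun h' => Real.log (θ.p t z h' a)) h (Pi.single τ (Pi.single j 1)) := by
  have hc := hind.continuous_p hsmooth t ha
  -- Where `p` is nonzero, `log p` is near `h` the sum of the logarithms of the mechanisms.
  have hsum : ∀ z', θ.p t z' h a ≠ 0 →
      fderiv ℝ (fun h' => Real.log (θ.p t z' h' a)) h (Pi.single τ (Pi.single j 1)) =
        ∑ k, fderiv ℝ (fun h' => Real.log (θ.mechanism t k (z' k) h' a)) h
          (Pi.single τ (Pi.single j 1)) := by
    intro z' hz'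
    have hev : (fun h' => Real.log (θ.p t z' h' a)) =ᶠ[𝓝 h]
        fun h' => ∑ k, Real.log (θ.mechanism t k (z' k) h' a) := by
      have hc' : ContinuousAt (fun h' => θ.p t z' h' a) h :=
        (hc.comp (by fun_prop : Continuous fun h' => (z', h'))).continuousAt
      filter_upwards [hc'.eventually_ne hz'] with h' hh'
      rw [(hind t h' a ha).2.2.2.1 z'] at hh' ⊢
      exact Real.log_prod fun k _ => Finset.prod_ne_zero_iff.mp hh' k (Finset.mem_univ k)
    rw [(hind t h a ha).2.2.2.1 z'] at hz'
    rw [hev.fderiv_eq, fderiv_fun_sum, sum_apply]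
    intro k _
    refine DifferentiableAt.log ?_ (Finset.prod_ne_zero_iff.mp hz' k (Finset.mem_univ k))
    exact ((hsmooth t k a ha).comp (contDiff_const.prodMk contDiff_id)).contDiffAt.differentiableAt
      two_ne_zero
  have hcz : ContinuousAt (fun s : ℝ => θ.p t (z + s • Pi.single i 1) h a) 0 :=
    (hc.comp (by fun_prop :
      Continuous fun s : ℝ => (z + s • (Pi.single i 1 : Fin dz → ℝ), h))).continuousAt
  filter_upwards [hcz.eventually_ne (by simpa using hp)] with s hs
  rw [hsum _ hs, hsum _ hp]
  refine Finset.sum_congr rfl fun k _ => ?_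
  -- Only the mechanism `i` sees the shift `s`, and its derivative along `z_j^τ` vanishes because
  -- `j` is not a parent of `i`.
  by_cases hk : k = i
  · subst hk
    have hz0 : ∀ x, fderiv ℝ (fun h' => Real.log (θ.mechanism t k x h' a)) h
        (Pi.single τ (Pi.single j 1)) = 0 := by
      refine fun x => fderiv_apply_eq_zero_of_const fun s => ?_
      rw [hmarkov t k (h + s • (Pi.single τ (Pi.single j 1) : Fin (t : ℕ) → Fin dz → ℝ)) h a a ha
        ha ?_ (fun _ _ _ => rfl)]
      intro r l hl
      have hlj : l ≠ j := fun h => by simp [h, hG] at hl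
      by_cases hr : r = τ
      · subst hr
        simp [hlj]
      · simp [hr]
    rw [hz0, hz0]
  · simp [hk]

/-- The relation between the Hessians of two models that are equivalent up to diffeomorphism, for
the entries absent from the graph of the second one. -/
lemma sum_mul_hessianLog_mul_eq_zero {v : (Fin dz → ℝ) → (Fin dz → ℝ)} (hv : IsDiffeo v)
    (hp : ∀ (t : Fin T) (a : Fin ((t : ℕ) + 1) → Fin da → ℝ), (∀ s, a s ∈ A) →
      ∀ (z : Fin dz → ℝ) (h : Fin (t : ℕ) → Fin dz → ℝ),
        θ'.p t z h a = θ.p t (v z) (fun s => v (h s)) a * |(fderiv ℝ v z).det|)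
    (hind : θ.CondIndep A) (hsmooth : θ.SmoothTransition A) (hind' : θ'.CondIndep A)
    (hmarkov' : θ'.Markov A) (hsmooth' : θ'.SmoothTransition A) {w : Fin dz → ℝ} {t : Fin T}
    {τ : Fin (t : ℕ)} {h : Fin (t : ℕ) → Fin dz → ℝ} {a : Fin ((t : ℕ) + 1) → Fin da → ℝ}
    (ha : ∀ s, a s ∈ A) (hτ : h τ = v w) (hpos : θ.p t (v w) h a ≠ 0) {i j : Fin dz}
    (hG : θ'.Gz i j = false) :
    ∑ k, ∑ l, fderiv ℝ v w (Pi.single i 1) k * θ.hessianLog t τ (v w) h a k l *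
      fderiv ℝ v w (Pi.single j 1) l = 0 := by
  choose u hu using hv.2
  obtain ⟨g, rfl⟩ : ∃ g : Fin (t : ℕ) → Fin dz → ℝ, (fun s => v (g s)) = h :=
    ⟨fun s => u (h s), funext fun s => hu _⟩
  -- The past latent at `τ` equals the present one, so both Jacobian factors are taken at the same
  -- point `w`.
  have hg : g τ = w := hv.1.2.1 hτ
  have hd : Differentiable ℝ v := hv.1.1.differentiable one_ne_zero
  set F : (Fin dz → ℝ) × (Fin (t : ℕ) → Fin dz → ℝ) → ℝ :=
    fun y => Real.log (θ.p t y.1 y.2 a) with hF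
  have hFc : ContDiffAt ℝ 2 F (v w, fun s => v (g s)) := hind.contDiffAt_log_p hsmooth t ha hpos
  let e : Fin (t : ℕ) → Fin dz → ℝ := Pi.single τ (Pi.single j 1)
  have hM := hasFDerivAt_fderiv_right (F' := fun y => Real.log (θ'.p t y.1 y.2 a))
    (ℓ := fun z => Real.log |(fderiv ℝ v z).det|) hFc (hd w).hasFDerivAt
    (hasFDerivAt_map_pi hd g) ?_ e
  · have hp' : θ'.p t w g a ≠ 0 := by
      rw [hp t a ha]
      exact mul_ne_zero hpos (abs_ne_zero.mpr (hv.det_fderiv_ne_zero w))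
    have h0 := hasFDerivAt_apply_eq_zero_of_const hM
      (eventually_fderiv_log_p_eq hind' hmarkov' hsmooth' t τ ha hp' hG)
    have he : (ContinuousLinearMap.pi fun s =>
        (fderiv ℝ v (g s)).comp (ContinuousLinearMap.proj s)) e =
          Pi.single τ (fderiv ℝ v w (Pi.single j 1)) := by
      funext s
      by_cases hs : s = τ
      · subst hs
        simp [e, hg]
      · simp [e, hs]
    rw [he] at h0
    let B := fderiv ℝ (fderiv ℝ F) (v w, fun s => v (g s))
    -- The block of the second derivative pairing `z^t` with `z^τ`, whose matrix in the standard
    -- basis is `hessianLog`.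
    let β := (B.flip ∘L (ContinuousLinearMap.inr ℝ (Fin dz → ℝ) (Fin (t : ℕ) → Fin dz → ℝ) ∘L
      ContinuousLinearMap.single ℝ (fun _ => Fin dz → ℝ) τ)).flip ∘L
        ContinuousLinearMap.inl ℝ (Fin dz → ℝ) (Fin (t : ℕ) → Fin dz → ℝ)
    have hβ : ∀ b c, β b c = B (b, 0) (0, Pi.single τ c) := fun b c => rfl
    have h1 : β (fderiv ℝ v w (Pi.single i 1)) (fderiv ℝ v w (Pi.single j 1)) = 0 := by
      rw [hβ]
      exact h0
    rw [bilin_apply_eq_sum] at h1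
    rw [← h1]
    refine Finset.sum_congr rfl fun k _ => Finset.sum_congr rfl fun l _ => ?_
    rw [hβ, ← fderiv_fderiv_left hFc]
    rfl
  · have hc : Continuous fun x => θ.p t (v x) (fun s => v (g s)) a :=
      (hind.continuous_p hsmooth t ha).comp
        (by have := hd.continuous; fun_prop : Continuous fun x => (v x, fun s => v (g s)))
    filter_upwards [hc.continuousAt.eventually_ne hpos] with x hx
    have hc2 : Continuous fun y : Fin (t : ℕ) → Fin dz → ℝ => θ.p t (v x) (fun s => v (y s)) a :=
      (hind.continuous_p hsmooth t ha).comp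
        (by have := hd.continuous; fun_prop :
          Continuous fun y : Fin (t : ℕ) → Fin dz → ℝ => (v x, fun s => v (y s)))
    filter_upwards [hc2.continuousAt.eventually_ne hx] with y hy
    rw [hp t a ha, Real.log_mul hy (abs_ne_zero.mpr (hv.det_fderiv_ne_zero x))]

/-- The sparsity constraint on the Jacobian of the entanglement map. -/
theorem fderiv_mul_fderiv_eq_zero {v : (Fin dz → ℝ) → (Fin dz → ℝ)} (hv : IsDiffeo v)
    (hp : ∀ (t : Fin T) (a : Fin ((t : ℕ) + 1) → Fin da → ℝ), (∀ s, a s ∈ A) →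
      ∀ (z : Fin dz → ℝ) (h : Fin (t : ℕ) → Fin dz → ℝ),
        θ'.p t z h a = θ.p t (v z) (fun s => v (h s)) a * |(fderiv ℝ v z).det|)
    (hind : θ.CondIndep A) (hsmooth : θ.SmoothTransition A) (hind' : θ'.CondIndep A)
    (hmarkov' : θ'.Markov A) (hsmooth' : θ'.SmoothTransition A) (hsuff : θ.SufficientInfluence A)
    {i j k l : Fin dz} (hG' : θ'.Gz i j = false) (hG : θ.Gz k l = true) (w : Fin dz → ℝ) :
    fderiv ℝ v w (Pi.single i 1) k * fderiv ℝ v w (Pi.single j 1) l = 0 := by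
  obtain ⟨⟨hv1, hvi, U, g, hU, hUr, hg, hgv⟩, hvs⟩ := id hv
  have hUuniv : U = Set.univ := Set.univ_subset_iff.mp (hvs.range_eq ▸ hUr)
  have hgc : Continuous g := by
    rw [← continuousOn_univ, ← hUuniv]
    exact hg.continuousOn
  -- A set of full measure is dense, and its image under the continuous surjection `g = v⁻¹` remains
  -- dense.
  have hdense : Dense {w | ∃ (t : Fin θ.Gz.nnz → Fin T) (τ : ∀ r, Fin (t r : ℕ))
      (h : ∀ r, Fin (t r : ℕ) → Fin dz → ℝ) (a : ∀ r, Fin ((t r : ℕ) + 1) → Fin da → ℝ),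
      (∀ r s, a r s ∈ A) ∧ (∀ r, h r (τ r) = v w) ∧ (∀ r, 0 < θ.p (t r) (v w) (h r) (a r)) ∧
      Submodule.span ℝ (Set.range fun r => θ.hessianLog (t r) (τ r) (v w) (h r) (a r)) =
        alignedSubspace θ.Gz} := by
    have hsurj : Function.Surjective g := fun z => ⟨v z, hgv z⟩
    refine (hsurj.denseRange.dense_image hgc (Measure.dense_of_ae hsuff)).mono ?_
    rintro _ ⟨z, hz, rfl⟩
    obtain ⟨w, rfl⟩ := hvs z
    rw [hgv]
    exact hz
  have hvd := hv1.continuous_fderiv one_ne_zero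
  have hcont : ∀ i k, Continuous fun w => fderiv ℝ v w (Pi.single i 1) k := fun i k =>
    (continuous_apply k).comp (hvd.clm_apply continuous_const)
  refine congrFun (Continuous.ext_on hdense ((hcont i k).mul (hcont j l)) continuous_const
    (g := fun _ => 0) fun w hw => ?_) w
  obtain ⟨t, τ, h, a, ha, hτ, hpos, hspan⟩ := hw
  -- The form `M ↦ (Dvᵀ M Dv) i j` kills the Hessians, hence their span; evaluating it at the matrix
  -- unit `(k, l)` isolates the desired product.
  let φ : Matrix (Fin dz) (Fin dz) ℝ →ₗ[ℝ] ℝ :=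
    { toFun := fun M => ∑ k, ∑ l, fderiv ℝ v w (Pi.single i 1) k * M k l *
        fderiv ℝ v w (Pi.single j 1) l
      map_add' := fun M N => by
        simp only [Matrix.add_apply, mul_add, add_mul, Finset.sum_add_distrib]
      map_smul' := fun c M => by
        simp only [Matrix.smul_apply, smul_eq_mul, RingHom.id_apply, Finset.mul_sum]
        refine Finset.sum_congr rfl fun _ _ => Finset.sum_congr rfl fun _ _ => by ring }
  have hle : alignedSubspace θ.Gz ≤ LinearMap.ker φ := by
    rw [← hspan, Submodule.span_le]
    rintro _ ⟨r, rfl⟩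
    exact sum_mul_hessianLog_mul_eq_zero hv hp hind hsmooth hind' hmarkov' hsmooth' (ha r) (hτ r)
      (hpos r).ne' hG'
  have hmem : Matrix.single k l (1 : ℝ) ∈ alignedSubspace θ.Gz := by
    intro k' l' h0
    rw [Matrix.single_apply, if_neg]
    rintro ⟨rfl, rfl⟩
    simp [hG] at h0
  have h2 : ∑ k', ∑ l', fderiv ℝ v w (Pi.single i 1) k' * Matrix.single k l (1 : ℝ) k' l' *
      fderiv ℝ v w (Pi.single j 1) l' = 0 := hle hmem
  rw [Finset.sum_eq_single k (fun b _ hb => Finset.sum_eq_zero fun c _ => by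
      simp [hb.symm]) (by simp),
    Finset.sum_eq_single l (fun b _ hb => by simp [hb.symm]) (by simp)] at h2
  simpa using h2

end Model

/-! ### Graphs, permutations and preserving maps -/

section Graphs

variable {m : ℕ}

lemma exists_perm_forall_ne_zero {L : (Fin m → ℝ) →L[ℝ] (Fin m → ℝ)} (hL : L.det ≠ 0) :
    ∃ π : Equiv.Perm (Fin m), ∀ k, L (Pi.single (π k) 1) k ≠ 0 := by
  rw [ContinuousLinearMap.det, ← LinearMap.det_toMatrix', Matrix.det_apply'] at hL
  obtain ⟨σ, -, hσ⟩ := Finset.exists_ne_zero_of_sum_ne_zero hL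
  -- The Leibniz formula pairs column `i` with row `σ i`, whereas a column is wanted for each row.
  refine ⟨σ⁻¹, fun k => ?_⟩
  have := Finset.prod_ne_zero_iff.mp (right_ne_zero_of_mul hσ) (σ⁻¹ k) (Finset.mem_univ _)
  simpa [LinearMap.toMatrix'_apply, Pi.single_apply] using this

lemma permMatrix_conj_apply (σ : Equiv.Perm (Fin m)) (M : Matrix (Fin m) (Fin m) ℝ)
    (i j : Fin m) :
    (σ.permMatrix ℝ * M * (σ.permMatrix ℝ).transpose) i j = M (σ i) (σ j) := by
  rw [Matrix.transpose_permMatrix, Equiv.Perm.permMatrix, Equiv.Perm.permMatrix,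
    PEquiv.toMatrix_toPEquiv_mul, PEquiv.mul_toMatrix_toPEquiv]
  rfl

lemma permMatrix_transpose_mulVec (σ : Equiv.Perm (Fin m)) (z : Fin m → ℝ) :
    (σ.permMatrix ℝ).transpose.mulVec z = fun i => z (σ.symm i) := by
  rw [Matrix.transpose_permMatrix, Matrix.permMatrix_mulVec]
  rfl

/-- `π × π` injects the edges of `G` into those of `G'`; the cardinality bound makes this a
bijection. -/
lemma eq_of_nnz_le {G G' : BinMatrix m m} {π : Equiv.Perm (Fin m)}
    (h : ∀ k l, G k l = true → G' (π k) (π l) = true) (hn : G'.nnz ≤ G.nnz) (k l : Fin m) :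
    G k l = G' (π k) (π l) := by
  have hsub : ((Finset.univ.filter fun q : Fin m × Fin m => G q.1 q.2 = true).map
      (π.prodCongr π).toEmbedding) ⊆
        Finset.univ.filter fun q : Fin m × Fin m => G' q.1 q.2 = true := by
    intro q hq
    obtain ⟨p, hp, rfl⟩ := Finset.mem_map.mp hq
    simpa using h _ _ (Finset.mem_filter.mp hp).2
  have heq := Finset.eq_of_subset_of_card_le hsub (by rw [Finset.card_map]; exact hn)
  rw [Bool.eq_iff_iff]
  refine ⟨h k l, fun h' => ?_⟩
  have hmem : (π k, π l) ∈ Finset.univ.filter fun q : Fin m × Fin m => G' q.1 q.2 = true := by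
    simpa using h'
  rw [← heq, Finset.mem_map] at hmem
  obtain ⟨⟨p, q⟩, hp, he⟩ := hmem
  have h1 : p = k ∧ q = l := by simpa using he
  rw [← h1.1, ← h1.2]
  exact (Finset.mem_filter.mp hp).2

/-- The preorder on the nodes of a graph given by inclusion of both rows and columns. -/
def Dominates (G : BinMatrix m m) (k i : Fin m) : Prop :=
  (∀ l, G k l = true → G i l = true) ∧ ∀ l, G l k = true → G l i = true

lemma Dominates.refl (G : BinMatrix m m) (k : Fin m) : Dominates G k k :=
  ⟨fun _ => id, fun _ => id⟩

lemma Dominates.trans {G : BinMatrix m m} {k i j : Fin m} (h : Dominates G k i)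
    (h' : Dominates G i j) : Dominates G k j :=
  ⟨fun l hl => h'.1 l (h.1 l hl), fun l hl => h'.2 l (h.2 l hl)⟩

/-- Each step of `ρ` goes up in the preorder, and `ρ` has finite order, so going on from `ρ k` leads
back to `k`. -/
lemma dominates_of_forall_perm {G : BinMatrix m m} {ρ : Equiv.Perm (Fin m)}
    (h : ∀ k, Dominates G k (ρ k)) (k : Fin m) : Dominates G (ρ k) k := by
  have hpow : ∀ n : ℕ, Dominates G (ρ k) ((ρ ^ n) (ρ k)) := fun n => by
    induction n with
    | zero => exact .refl G _
    | succ n ih =>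
      rw [pow_succ', Equiv.Perm.mul_apply]
      exact ih.trans (h _)
  have := hpow (orderOf ρ - 1)
  rwa [← Equiv.Perm.mul_apply, ← pow_succ, Nat.sub_add_cancel (orderOf_pos ρ), pow_orderOf_eq_one,
    Equiv.Perm.one_apply] at this

/-- Over a connected space, a continuous family of invertible matrices subject to the quadratic
sparsity constraints of a graph, one of which has nonzero diagonal, takes values in the matrices
aligned with the preorder `Dominates G`. -/
lemma dominates_of_ne_zero {X : Type*} [TopologicalSpace X] [PreconnectedSpace X]
    {G : BinMatrix m m} {M : X → Fin m → Fin m → ℝ} (hM : ∀ k i, Continuous fun x => M x k i)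
    (hperm : ∀ x, ∃ ρ : Equiv.Perm (Fin m), ∀ k, M x k (ρ k) ≠ 0)
    (hG : ∀ x k l i j, G k l = true → G i j = false → M x k i * M x l j = 0)
    {x₀ : X} (hx₀ : ∀ k, M x₀ k k ≠ 0) (x : X) {k i : Fin m} (hki : M x k i ≠ 0) :
    Dominates G k i := by
  have hG' : ∀ x k l i j, G k l = true → M x k i ≠ 0 → M x l j ≠ 0 → G i j = true := by
    intro x k l i j hkl h1 h2
    by_contra h3
    exact mul_ne_zero h1 h2 (hG x k l i j hkl (by simpa using h3))
  let S : Set X := {x | ∀ k i, ¬ Dominates G k i → M x k i = 0}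
  have hclosed : IsClosed S := by
    simp only [S, Set.ofPred_forall]
    exact isClosed_iInter fun k => isClosed_iInter fun i => isClosed_iInter fun _ =>
      isClosed_eq (hM k i) continuous_const
  -- At a point of `S` the transversal `ρ` goes up in the preorder, so `ρ l` and `l` are equivalent
  -- nodes. The entries `(l, ρ l)` stay nonzero nearby and there play the role of a nonzero
  -- diagonal.
  have hopen : IsOpen S := by
    rw [isOpen_iff_mem_nhds]
    intro x hx
    obtain ⟨ρ, hρ⟩ := hperm x
    have hdom : ∀ k, Dominates G k (ρ k) := fun k => by
      by_contra h
      exact hρ k (hx k _ h)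
    have hev : ∀ᶠ y in 𝓝 x, ∀ k, M y k (ρ k) ≠ 0 :=
      eventually_all.mpr fun k => (hM k (ρ k)).continuousAt.eventually_ne (hρ k)
    filter_upwards [hev] with y hy k i hki
    by_contra h0
    refine hki ⟨fun l hl => ?_, fun l hl => ?_⟩
    · exact (dominates_of_forall_perm hdom l).2 i (hG' y k l i (ρ l) hl h0 (hy l))
    · exact (dominates_of_forall_perm hdom l).1 i (hG' y l k (ρ l) i hl (hy l) h0)
  have hmem : x₀ ∈ S := fun k i hki => by
    by_contra h0
    exact hki ⟨fun l hl => hG' x₀ k l i l hl h0 (hx₀ l), fun l hl => hG' x₀ l k l i hl (hx₀ l) h0⟩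
  have huniv : S = Set.univ := IsClopen.eq_univ ⟨hclosed, hopen⟩ ⟨x₀, hmem⟩
  by_contra h
  exact hki ((huniv ▸ Set.mem_univ x : x ∈ S) k i h)

lemma exists_fderiv_ne_zero_of_dependencyGraph {c : (Fin m → ℝ) → (Fin m → ℝ)}
    (hc : Differentiable ℝ c) {k i : Fin m} (h : dependencyGraph c k i = true) :
    ∃ u, fderiv ℝ c u (Pi.single i 1) k ≠ 0 := by
  by_contra! h0
  refine absurd h ?_
  rw [dependencyGraph, Matrix.of_apply, if_pos]
  · simp
  -- If `∂_i c_k` vanishes everywhere, `c_k` is constant on lines parallel to the `i`-th axis, so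
  -- coordinate `i` may be set to `0`.
  refine ⟨fun y => c (fun l => if hl : l = i then 0 else y ⟨l, hl⟩) k, fun a => ?_⟩
  have hline : ∀ s : ℝ, HasDerivAt (fun s : ℝ => c (a + s • (Pi.single i 1 : Fin m → ℝ)) k) 0 s := by
    intro s
    have h1 : HasDerivAt (fun s : ℝ => a + s • (Pi.single i 1 : Fin m → ℝ)) (Pi.single i 1) s := by
      simpa using ((hasDerivAt_id s).smul_const (Pi.single i 1 : Fin m → ℝ)).const_add a
    have h2 := hasDerivAt_pi.mp ((hc _).hasFDerivAt.comp_hasDerivAt s h1) k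
    rwa [h0] at h2
  have := is_const_of_deriv_eq_zero (fun s => (hline s).differentiableAt)
    (fun s => (hline s).deriv) 0 (-a i)
  simp only [zero_smul, add_zero] at this
  rw [this]
  congr 2
  funext l
  by_cases hl : l = i
  · subst hl
    simp
  · simp [hl]

/-- An edge of the dependency graph is witnessed by a nonzero partial derivative at some point, so a
row inclusion known at every point covers all edges. -/
lemma preservingFunction_of_fderiv {G : BinMatrix m m} {c : (Fin m → ℝ) → (Fin m → ℝ)}
    (hc : Differentiable ℝ c)
    (h : ∀ u k i, fderiv ℝ c u (Pi.single i 1) k ≠ 0 → ∀ l, G k l = true → G i l = true) :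
    PreservingFunction G c := by
  intro M hM i l hil
  rw [Matrix.mul_apply]
  refine Finset.sum_eq_zero fun k _ => ?_
  rw [Matrix.transpose_apply, BinMatrix.toReal, Matrix.of_apply]
  split_ifs with hd
  · obtain ⟨u, hu⟩ := exists_fderiv_ne_zero_of_dependencyGraph hc hd
    rw [hM k l, mul_zero]
    by_contra hkl
    have := h u k i hu l (by simpa using hkl)
    simp [hil] at this
  · rw [zero_mul]

/-- The sparsity constraint on the Jacobian of `v` gives a permutation that embeds the first graph
into the second one. -/
lemma exists_perm_embedding {G G' : BinMatrix m m} {v : (Fin m → ℝ) → (Fin m → ℝ)}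
    (hv : IsDiffeo v)
    (hJ : ∀ i j k l, G' i j = false → G k l = true → ∀ w,
      fderiv ℝ v w (Pi.single i 1) k * fderiv ℝ v w (Pi.single j 1) l = 0) :
    ∃ π : Equiv.Perm (Fin m), (∀ k, fderiv ℝ v 0 (Pi.single (π k) 1) k ≠ 0) ∧
      ∀ k l, G k l = true → G' (π k) (π l) = true := by
  obtain ⟨π, hπ⟩ := exists_perm_forall_ne_zero (hv.det_fderiv_ne_zero 0)
  refine ⟨π, hπ, fun k l hkl => ?_⟩
  by_contra h
  exact mul_ne_zero (hπ k) (hπ l) (hJ _ _ k l (by simpa using h) hkl 0)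

/-- When the two graphs have the same number of edges, the map `v` is a permutation followed by a
map that preserves the first graph and its transpose. -/
lemma exists_preserving_decomposition {G G' : BinMatrix m m} {v : (Fin m → ℝ) → (Fin m → ℝ)}
    (hv : IsDiffeo v)
    (hJ : ∀ i j k l, G' i j = false → G k l = true → ∀ w,
      fderiv ℝ v w (Pi.single i 1) k * fderiv ℝ v w (Pi.single j 1) l = 0)
    {π : Equiv.Perm (Fin m)} (hπ : ∀ k, fderiv ℝ v 0 (Pi.single (π k) 1) k ≠ 0)
    (hGG' : ∀ k l, G k l = G' (π k) (π l)) :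
    ∃ c : (Fin m → ℝ) → (Fin m → ℝ), IsDiffeo c ∧ PreservingFunction G c ∧
      PreservingFunction G.transpose c ∧ ∀ z, v z = c fun i => z (π i) := by
  -- `S` sends the basis vector `i` to the basis vector `π i`, so the Jacobian of `v ∘ S` at `0` has
  -- nonzero diagonal.
  let S : (Fin m → ℝ) →L[ℝ] (Fin m → ℝ) :=
    ContinuousLinearMap.pi fun i => ContinuousLinearMap.proj (π.symm i)
  let S' : (Fin m → ℝ) →L[ℝ] (Fin m → ℝ) :=
    ContinuousLinearMap.pi fun i => ContinuousLinearMap.proj (π i)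
  have hSS' : ∀ z, S (S' z) = z := fun z => funext fun i => by simp [S, S']
  have hS'S : ∀ z, S' (S z) = z := fun z => funext fun i => by simp [S, S']
  have hvd : Differentiable ℝ v := hv.1.1.differentiable one_ne_zero
  have hSsingle : ∀ i, S (Pi.single i 1) = Pi.single (π i) 1 := fun i => funext fun k => by
    simp [S, Pi.single_apply, Equiv.symm_apply_eq]
  have hc1 : ContDiff ℝ 1 fun u => v (S u) := hv.1.1.comp S.contDiff
  have hcd : Differentiable ℝ fun u => v (S u) := hc1.differentiable one_ne_zero
  have hfd : ∀ u i, fderiv ℝ (fun u => v (S u)) u (Pi.single i 1) =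
      fderiv ℝ v (S u) (Pi.single (π i) 1) := fun u i => by
    have : HasFDerivAt (fun u => v (S u)) (fderiv ℝ v (S u) ∘L S) u :=
      HasFDerivAt.comp u (hvd (S u)).hasFDerivAt S.hasFDerivAt
    rw [this.fderiv, ContinuousLinearMap.comp_apply, hSsingle]
  have hdiffeo : IsDiffeo fun u => v (S u) := by
    obtain ⟨⟨-, -, U, g, hU, hUr, hg, hgv⟩, hvs⟩ := hv
    have hUuniv : U = Set.univ := Set.univ_subset_iff.mp (hvs.range_eq ▸ hUr)
    have hg' : ContDiff ℝ 1 g := contDiffOn_univ.mp (hUuniv ▸ hg)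
    refine isDiffeo_of_inverse hc1 (S'.contDiff.comp hg') (fun u => ?_) (fun z => ?_)
    · simp [hgv, hS'S]
    · obtain ⟨w, rfl⟩ := hvs z
      simp [hgv, hSS']
  have hdom : ∀ u k i, fderiv ℝ (fun u => v (S u)) u (Pi.single i 1) k ≠ 0 →
      Dominates G k i := fun u k i => by
    refine dominates_of_ne_zero
      (M := fun u k i => fderiv ℝ (fun u => v (S u)) u (Pi.single i 1) k) (fun k i => ?_)
      (fun u => exists_perm_forall_ne_zero (hdiffeo.det_fderiv_ne_zero u))
      (fun u k l i j hkl hij => ?_) (x₀ := 0) (fun k => ?_) u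
    · exact (continuous_apply k).comp
        ((hc1.continuous_fderiv one_ne_zero).clm_apply continuous_const)
    · rw [hfd, hfd]
      exact hJ _ _ k l (by rw [← hGG', hij]) hkl _
    · rw [hfd, map_zero]
      exact hπ k
  refine ⟨fun u => v (S u), hdiffeo,
    preservingFunction_of_fderiv hcd fun u k i h => (hdom u k i h).1,
    preservingFunction_of_fderiv hcd fun u k i h => (hdom u k i h).2, fun z => ?_⟩
  exact congrArg v (hSS' z).symm

end Graphs

end MechanismSparsity

/-! ### The main theorem -/

open MechanismSparsity
theorem mainTheorem3 {dz dx da T : ℕ} (hT : 0 < T) (σ2 : ℝ≥0)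
    (A : Set (Fin da → ℝ)) (hA : A.Nonempty) (θ θ' : Model dz dx da T)
    (hobs : θ.ObservationModel) (hobs' : θ'.ObservationModel)
    (hind : θ.CondIndep A) (hind' : θ'.CondIndep A)
    (hmarkov : θ.Markov A) (hmarkov' : θ'.Markov A)
    (hsmooth : θ.SmoothTransition A) (hsmooth' : θ'.SmoothTransition A)
    (hequiv : Model.ObsEquiv σ2 A θ θ')
    (hsuff : θ.SufficientInfluence A) :
    (∃ π : Equiv.Perm (Fin dz),
      SuppSubset (π.permMatrix ℝ * θ.Gz.toReal * (π.permMatrix ℝ).transpose) θ'.Gz.toReal) ∧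
    (θ'.Gz.nnz ≤ θ.Gz.nnz → Model.ZConsistent A θ θ') := by
  have hdiff := Model.diffEquiv_of_obsEquiv hT hA hobs hobs' hind hind' hsmooth hsmooth' hequiv
  obtain ⟨-, hv, hp⟩ := id hdiff
  have hJ : ∀ i j k l, θ'.Gz i j = false → θ.Gz k l = true → ∀ w, _ :=
    fun i j k l hG' hG w => Model.fderiv_mul_fderiv_eq_zero hv hp hind hsmooth hind' hmarkov'
      hsmooth' hsuff hG' hG w
  obtain ⟨π, hπ, hGG'⟩ := exists_perm_embedding hv hJ
  -- Conjugation by the matrix of `σ` reads the entry `(σ i, σ j)`, while `π` maps nodes of `G` to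
  -- nodes of `G'`; hence `σ = π⁻¹`.
  refine ⟨⟨π.symm, fun i j hij => ?_⟩, fun hn => ?_⟩
  · rw [permMatrix_conj_apply] at hij
    have h1 : θ.Gz (π.symm i) (π.symm j) = true := by
      by_contra h
      simp [BinMatrix.toReal, h] at hij
    have h2 := hGG' _ _ h1
    rw [Equiv.apply_symm_apply, Equiv.apply_symm_apply] at h2
    simp [BinMatrix.toReal, h2]
  · have heq := eq_of_nnz_le hGG' hn
    obtain ⟨c, hc, hc1, hc2, hvc⟩ := exists_preserving_decomposition hv hJ hπ heq
    refine ⟨π.symm, _, rfl, hdiff, ?_, c, hc, hc1, hc2, fun z => ?_⟩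
    · ext i j
      rw [permMatrix_conj_apply]
      simp [BinMatrix.toReal, heq]
    · rw [permMatrix_transpose_mulVec, hvc, Equiv.symm_symm]
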